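/- Let $d\ge 3$. For $x\in\mathbb Z^d$ let $P_x$ be the law of simple random walk $(X_n)_{n\ge0}$ on $\mathbb Z^d$ started at $x$, let $g(x,y)=\sum_{n\ge 0}P_x[X_n=y]$ be the Green function, and for finite $K\subset\mathbb Z^d$ let $e_K(x)=P_x[X_n\notin K\text{ for all }n\ge1]\,1_K(x)$. Let $\widehat W$ be the space of doubly infinite sequences $(X_n,\sigma_n)_{n\in\mathbb Z}$ in $\mathbb Z^d\times(0,\infty)$ such that $(X_n)$ is a nearest neighbour trajectory visiting each site finitely often and $\sum_{n\ge0}\sigma_n=\sum_{n\le0}\sigma_n=\infty$; let $\widehat W^*$ be its quotient by time shift, $\pi^*$ the projection, each with its canonical $\sigma$-algebra. Let $\widehat\nu$ be the unique measure on $\widehat W^*$ whose restriction to the trajectories entering $K$ is, for every finite $K\subset\mathbb Z^d$, the image under $\pi^*$ of the measure $\widehat Q_K$ such that $\widehat Q_K(X_0=x)=e_K(x)$ and, when $e_K(x)>0$, conditionally on $X_0=x$, $(X_n)_{n\ge0}$, $(X_{-n})_{n\ge0}$, $(\sigma_n)_{n\in\mathbb Z}$ are independent and distributed respectively as simple random walk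 from $x$, as simple random walk from $x$ conditioned never to return to $K$, and as i.i.d. exponential variables with parameter $1$. Let $\omega=\sum_i\delta_{(\widehat w^*_i,u_i)}$ be a Poisson point process on $\widehat W^*\times[0,\infty)$ with intensity $\widehat\nu(d\widehat w^*)\,du$ (continuous time random interlacements), and let $$L_{x,u}=\sum_i\sum_{n\in\mathbb Z}\sigma_n(\widehat w_i)\,1\{X_n(\widehat w_i)=x,\ u_i\le u\},\qquad \pi^*(\widehat w_i)=\widehat w_i^*,$$ be the occupation time of $x$ at level $u$. Let $(\gamma_x)_{x\in\mathbb Z^d}$ be the Gaussian free field on $\mathbb Z^d$, that is, a centered Gaussian field with $E[\gamma_x\gamma_y]=g(x,y)$. Then, as $u\to\infty$, $$\Big(\frac{L_{x,u}-L_{0,u}}{\sqrt{2u}}\Big)_{x\in\mathbb Z^d}\ \text{ converges in distribution to }\ (\gamma_x-\gamma_0)_{x\in\mathbb Z^d},$$ and $$\Big(\frac{L_{x,u}}{u}\Big)_{x\in\mathbb Z^d}\ \text{ converges in distribution to the constant field equal to }1,$$ both as random elements of $\mathbb R^{\mathbb Z^d}$ with the product topology. -/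

import Mathlib

open MeasureTheory ProbabilityTheory Filter
open scoped ENNReal NNReal

noncomputable section

namespace Interlacement

/-! ### Simple random walk, Green function, equilibrium measure -/

/-- The lattice `ℤ^d`. -/
abbrev Site (d : ℕ) : Type := Fin d → ℤ

/-- `x` and `y` are nearest neighbours in `ℤ^d`. -/
def IsNeighbor {d : ℕ} (x y : Site d) : Prop :=
  ∃ i : Fin d, y - x = Pi.single i 1 ∨ y - x = -Pi.single i 1

/-- The uniform distribution on the `2d` neighbours of the origin. -/
def stepLaw (d : ℕ) : Measure (Site d) :=
  (2 * d : ℝ≥0∞)⁻¹ •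
    ∑ i : Fin d, (Measure.dirac (Pi.single i (1 : ℤ)) + Measure.dirac (-Pi.single i (1 : ℤ)))

instance (d : ℕ) [NeZero d] : IsProbabilityMeasure (stepLaw d) where
  measure_univ := by
    have h0 : (2 * d : ℝ≥0∞) ≠ 0 := by simp [NeZero.ne d]
    have h1 : (2 * d : ℝ≥0∞) ≠ ∞ := ENNReal.mul_ne_top (by simp) (by simp)
    simp only [stepLaw, Measure.smul_apply, Measure.finsetSum_apply, Measure.add_apply,
      measure_univ, Finset.sum_const, Finset.card_univ, Fintype.card_fin, smul_eq_mul,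
      nsmul_eq_mul]
    rw [show (d : ℝ≥0∞) * (1 + 1) = 2 * d by ring]
    exact ENNReal.inv_mul_cancel h0 h1

instance : IsProbabilityMeasure (expMeasure 1) := isProbabilityMeasure_expMeasure one_pos

/-- The trajectory started at `x` with increments `ξ`. -/
def walkPath {d : ℕ} (x : Site d) (ξ : ℕ → Site d) : ℕ → Site d :=
  fun n => x + ∑ k ∈ Finset.range n, ξ k

/-- The law `P_x` of simple random walk on `ℤ^d` started at `x`. -/
def walkLaw {d : ℕ} [NeZero d] (x : Site d) : Measure (ℕ → Site d) :=
  (Measure.infinitePi fun _ : ℕ => stepLaw d).map (walkPath x)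

/-- The Green function `g(x, y) = ∑ₙ P_x[Xₙ = y]`. -/
def green {d : ℕ} [NeZero d] (x y : Site d) : ℝ :=
  (∑' n : ℕ, walkLaw x {f | f n = y}).toReal

/-- The event that the trajectory does not visit `K` at any time `n ≥ 1`. -/
def noReturn {d : ℕ} (K : Finset (Site d)) : Set (ℕ → Site d) :=
  {f | ∀ n : ℕ, 1 ≤ n → f n ∉ K}

/-- The equilibrium measure `e_K(x) = P_x[no return to K] 1_K(x)`. -/
def equilibrium {d : ℕ} [NeZero d] (K : Finset (Site d)) (x : Site d) : ℝ≥0∞ :=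
  if x ∈ K then walkLaw x (noReturn K) else 0

/-! ### The trajectory spaces -/

/-- All doubly infinite sequences of (position, holding time). -/
abbrev RawPath (d : ℕ) : Type := ℤ → Site d × ℝ

/-- The doubly infinite nearest neighbour trajectories that spend finite time in each finite set,
decorated by positive holding times with infinite forward and backward sums. -/
def pathSet (d : ℕ) : Set (RawPath d) :=
  {w | (∀ n, IsNeighbor (w n).1 (w (n + 1)).1) ∧
    (∀ x : Site d, {n : ℤ | (w n).1 = x}.Finite) ∧
    (∀ n, 0 < (w n).2) ∧
    (∑' n : ℕ, ENNReal.ofReal (w n).2) = ∞ ∧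
    (∑' n : ℕ, ENNReal.ofReal (w (-n)).2) = ∞}

/-- The space of decorated doubly infinite trajectories, with the trace of the product
`σ`-algebra. -/
abbrev Path (d : ℕ) : Type := pathSet d

/-- Equality up to time shift. -/
instance pathSetoid (d : ℕ) : Setoid (Path d) where
  r w w' := ∃ k : ℤ, ∀ n, w.1 n = w'.1 (n + k)
  iseqv :=
    { refl := fun w => ⟨0, fun n => by simp⟩
      symm := fun {w w'} ⟨k, h⟩ => ⟨-k, fun n => by simp [h]⟩
      trans := fun {w w' w''} ⟨k, h⟩ ⟨l, h'⟩ => ⟨k + l, fun n => by rw [h, h', add_assoc]⟩ }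

/-- Trajectories modulo time shift, with the quotient `σ`-algebra. -/
abbrev PathMod (d : ℕ) : Type := Quotient (pathSetoid d)

/-- The canonical projection. -/
def proj (d : ℕ) : Path d → PathMod d := Quotient.mk _

/-- The trajectories modulo time shift that enter `K`. -/
def enters {d : ℕ} (K : Finset (Site d)) : Set (PathMod d) :=
  proj d '' {w | ∃ n, (w.1 n).1 ∈ K}

/-! ### The intensity measure -/

/-- Glue a forward trajectory, a backward trajectory and holding times. -/
def glue {d : ℕ} (p : ((ℕ → Site d) × (ℕ → Site d)) × (ℤ → ℝ)) : RawPath d :=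
  fun n => (if 0 ≤ n then p.1.1 n.toNat else p.1.2 (-n).toNat, p.2 n)

/-- The measure `Q_K` on all sequences: `X₀ = x` has mass `e_K(x)` and, given `X₀ = x`, the forward
trajectory is a simple random walk from `x`, the backward trajectory is a simple random walk
from `x` conditioned never to return to `K`, the holding times are i.i.d. exponential variables
of parameter `1`, and the three are independent. -/
def rawQ {d : ℕ} [NeZero d] (K : Finset (Site d)) : Measure (RawPath d) :=
  ∑ x ∈ K, equilibrium K x •
    (((walkLaw x).prod (ProbabilityTheory.cond (walkLaw x) (noReturn K))).prod
      (Measure.infinitePi fun _ : ℤ => expMeasure 1)).map glue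

/-- The measure `Q_K` on the space of trajectories. -/
def entranceMeasure {d : ℕ} [NeZero d] (K : Finset (Site d)) : Measure (Path d) :=
  (rawQ K).comap Subtype.val

/-- `ν` is an intensity measure of random interlacements: for each finite `K` its restriction to
the trajectories entering `K` is the image of `Q_K`. -/
def IsIntensity {d : ℕ} [NeZero d] (ν : Measure (PathMod d)) : Prop :=
  ∀ K : Finset (Site d), ν.restrict (enters K) = (entranceMeasure K).map (proj d)

/-- The intensity measure `ν` on trajectories modulo time shift, as the supremum over finite `K`
of the images of `Q_K`. It is the one and only measure that satisfies `IsIntensity`; see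
`isIntensity_iff` below. -/
def intensity (d : ℕ) [NeZero d] : Measure (PathMod d) :=
  ⨆ K : Finset (Site d), (entranceMeasure K).map (proj d)

/-! ### Poisson point processes and random interlacements -/

/-- `N` is, under `P`, a Poisson point process on `E` with intensity measure `μ`. -/
structure IsPoissonPointProcess {Ω E : Type*} [MeasurableSpace Ω] [MeasurableSpace E]
    (N : Ω → Measure E) (μ : Measure E) (P : Measure Ω) : Prop where
  measurable : Measurable N
  /-- Each realization is a countable sum of Dirac masses. -/
  point : ∀ ω, ∃ (s : Set ℕ) (p : ℕ → E), N ω = Measure.sum fun i : s => Measure.dirac (p i)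
  poisson : ∀ A, MeasurableSet A → μ A ≠ ∞ →
    HasLaw (fun ω => N ω A)
      ((poissonMeasure (μ A).toNNReal).map fun n : ℕ => (n : ℝ≥0∞)) P
  infinite : ∀ A, MeasurableSet A → μ A = ∞ → ∀ᵐ ω ∂P, N ω A = ∞
  indep : ∀ (n : ℕ) (A : Fin n → Set E), (∀ i, MeasurableSet (A i)) →
    Pairwise (fun i j => Disjoint (A i) (A j)) → iIndepFun (fun i ω => N ω (A i)) P

/-- Lebesgue measure on `[0, ∞)`. -/
def levelMeasure : Measure ℝ≥0 := (volume : Measure ℝ).comap ((↑) : ℝ≥0 → ℝ)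

/-- `N` is the continuous time interlacement point process on `ℤ^d`: a Poisson point process of
labelled trajectories modulo time shift with intensity `ν(dw) du`. -/
def IsInterlacementProcess {d : ℕ} [NeZero d] {Ω : Type*} [MeasurableSpace Ω]
    (N : Ω → Measure (PathMod d × ℝ≥0)) (P : Measure Ω) : Prop :=
  IsPoissonPointProcess N ((intensity d).prod levelMeasure) P

/-- The total time spent at `x` by a trajectory. -/
def pathTime {d : ℕ} (x : Site d) (w : Path d) : ℝ≥0∞ :=
  ∑' n : ℤ, if (w.1 n).1 = x then ENNReal.ofReal (w.1 n).2 else 0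

/-- The total time spent at `x` by a trajectory modulo time shift. -/
def pathModTime {d : ℕ} (x : Site d) : PathMod d → ℝ≥0∞ :=
  Quotient.lift (pathTime x) (by
    rintro w w' ⟨k, h⟩
    simp only [pathTime, h]
    exact (Equiv.addRight k).tsum_eq
      (fun n => if (w'.1 n).1 = x then ENNReal.ofReal (w'.1 n).2 else 0))

/-- The occupation time `L_{x,u}` in `[0, ∞]`: the total time spent at `x` by the trajectories
with label at most `u` of the point measure `η`; see `occupation_sum_dirac`. -/
def occupation {d : ℕ} (η : Measure (PathMod d × ℝ≥0)) (x : Site d) (u : ℝ) : ℝ≥0∞ :=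
  ∫⁻ p, (if (p.2 : ℝ) ≤ u then pathModTime x p.1 else 0) ∂η

/-- The occupation time `L_{x,u}` as a real number. -/
def occupationTime {d : ℕ} (η : Measure (PathMod d × ℝ≥0)) (x : Site d) (u : ℝ) : ℝ :=
  (occupation η x u).toReal

/-- `γ` is the Gaussian free field on `ℤ^d`: the centered Gaussian field with covariance `g`. -/
structure IsGaussianFreeField {d : ℕ} [NeZero d] {Ω : Type*} [MeasurableSpace Ω]
    (γ : Site d → Ω → ℝ) (P : Measure Ω) : Prop where
  gaussian : IsGaussianProcess γ P
  centered : ∀ x, ∫ ω, γ x ω ∂P = 0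
  covariance : ∀ x y, ∫ ω, γ x ω * γ y ω ∂P = green x y


/-! ### The intensity measure is well defined -/

lemma measurable_walkPath {d : ℕ} (x : Site d) : Measurable (walkPath x) := by
  unfold walkPath; fun_prop

instance {d : ℕ} [NeZero d] (x : Site d) : IsProbabilityMeasure (walkLaw x) :=
  Measure.isProbabilityMeasure_map (measurable_walkPath x).aemeasurable

lemma measurableSet_noReturn {d : ℕ} (K : Finset (Site d)) : MeasurableSet (noReturn K) := by
  have : noReturn K = ⋂ n : ℕ, ⋂ _ : 1 ≤ n, (fun f : ℕ → Site d => f n) ⁻¹' {x | x ∉ K} := by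
    ext; simp [noReturn]
  rw [this]
  exact .iInter fun n => .iInter fun _ => measurable_pi_apply n (Set.to_countable _).measurableSet

lemma measurable_glue {d : ℕ} : Measurable (glue (d := d)) := by
  refine measurable_pi_iff.2 fun n => ?_
  unfold glue
  split_ifs <;> fun_prop

/-- The law of the two-sided walk, with counting measure as initial distribution. -/
def twoSided (d : ℕ) [NeZero d] : Measure (RawPath d) :=
  Measure.sum fun x : Site d => (((walkLaw x).prod (walkLaw x)).prod
    (Measure.infinitePi fun _ : ℤ => expMeasure 1)).map glue

/-- The trajectories that enter `K` for the first time at time `k`. -/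
def firstAt {d : ℕ} (K : Finset (Site d)) (k : ℤ) : Set (RawPath d) :=
  {w | (w k).1 ∈ K ∧ ∀ n, n < k → (w n).1 ∉ K}

lemma measurableSet_pos {d : ℕ} (S : Set (Site d)) (n : ℤ) :
    MeasurableSet {w : RawPath d | (w n).1 ∈ S} :=
  (measurable_fst.comp (measurable_pi_apply n)) (Set.to_countable S).measurableSet

lemma measurableSet_firstAt {d : ℕ} (K : Finset (Site d)) (k : ℤ) :
    MeasurableSet (firstAt K k) := by
  have : firstAt K k = {w : RawPath d | (w k).1 ∈ (K : Set (Site d))} ∩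
      ⋂ n : ℤ, ⋂ _ : n < k, {w : RawPath d | (w n).1 ∈ (K : Set (Site d))ᶜ} := by
    ext; simp [firstAt]
  rw [this]
  exact (measurableSet_pos _ _).inter
    (.iInter fun n => .iInter fun _ => measurableSet_pos _ _)

lemma rawQ_eq_restrict {d : ℕ} [NeZero d] (K : Finset (Site d)) :
    rawQ K = (twoSided d).restrict (firstAt K 0) := by
  classical
  have key : ∀ x : Site d, ((((walkLaw x).prod (walkLaw x)).prod
      (Measure.infinitePi fun _ : ℤ => expMeasure 1)).map glue).restrict (firstAt K 0) =
      if x ∈ K then equilibrium K x •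
    (((walkLaw x).prod (ProbabilityTheory.cond (walkLaw x) (noReturn K))).prod
      (Measure.infinitePi fun _ : ℤ => expMeasure 1)).map glue else 0 := by
    intro x
    have h0 : ∀ᵐ f ∂(walkLaw x), f 0 = x := by
      unfold walkLaw
      have hs : MeasurableSet {f : ℕ → Site d | f 0 = x} :=
        (measurable_pi_apply (X := fun _ : ℕ => Site d) 0) (measurableSet_singleton x)
      refine (ae_map_iff (measurable_walkPath x).aemeasurable hs).2 ?_
      simp [walkPath]
    rw [Measure.restrict_map measurable_glue (measurableSet_firstAt K 0)]
    by_cases hx : x ∈ K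
    · rw [if_pos hx, ← Measure.map_smul, ← Measure.prod_smul_left, ← Measure.prod_smul_right]
      have h1 : equilibrium K x • ProbabilityTheory.cond (walkLaw x) (noReturn K) =
          (walkLaw x).restrict (noReturn K) := by
        rw [equilibrium, if_pos hx, ProbabilityTheory.cond, smul_smul]
        by_cases hz : walkLaw x (noReturn K) = 0
        · rw [hz, zero_mul, zero_smul, Measure.restrict_eq_zero.2 hz]
        · rw [ENNReal.mul_inv_cancel hz (measure_ne_top _ _), one_smul]
      rw [h1]
      congr 1
      have h2 : ((walkLaw x).prod ((walkLaw x).restrict (noReturn K))).prod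
          (Measure.infinitePi fun _ : ℤ => expMeasure 1) =
          (((walkLaw x).prod (walkLaw x)).prod
          (Measure.infinitePi fun _ : ℤ => expMeasure 1)).restrict
            ((Set.univ ×ˢ noReturn K) ×ˢ Set.univ) := by
        rw [← Measure.prod_restrict, ← Measure.prod_restrict]
        simp
      rw [h2]
      refine Measure.restrict_congr_set ?_
      have h3 : ∀ᵐ p ∂(((walkLaw x).prod (walkLaw x)).prod
          (Measure.infinitePi fun _ : ℤ => expMeasure 1)), p.1.1 0 = x :=
        (Measure.quasiMeasurePreserving_fst.ae (Measure.quasiMeasurePreserving_fst.ae h0))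
      filter_upwards [h3] with p hp
      apply propext
      show glue p ∈ firstAt K 0 ↔ p ∈ (Set.univ ×ˢ noReturn K) ×ˢ Set.univ
      simp only [firstAt, glue, Set.mem_ofPred_eq, le_refl, if_true, Int.toNat_zero, hp, hx,
        true_and, Set.mem_prod, Set.mem_univ, and_true, noReturn]
      constructor
      · intro h n hn
        have := h (-n) (by omega)
        rwa [if_neg (by omega), neg_neg, Int.toNat_natCast] at this
      · intro h n hn
        rw [if_neg (by omega)]
        exact h _ (by omega)
    · rw [if_neg hx]
      rw [Measure.map_eq_zero_iff measurable_glue.aemeasurable, Measure.restrict_eq_zero]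
      have h3 : ∀ᵐ p ∂(((walkLaw x).prod (walkLaw x)).prod
          (Measure.infinitePi fun _ : ℤ => expMeasure 1)), p.1.1 0 = x :=
        (Measure.quasiMeasurePreserving_fst.ae (Measure.quasiMeasurePreserving_fst.ae h0))
      refine measure_mono_null ?_ h3
      intro p hp hp'
      apply hx
      have := hp.1
      simp only [glue, le_refl, if_true, Int.toNat_zero] at this
      have h4 : p.1.1 0 = x := hp'
      rwa [h4] at this
  rw [twoSided, Measure.restrict_sum _ (measurableSet_firstAt K 0), rawQ]
  simp_rw [key]
  ext A hA
  rw [Measure.sum_apply _ hA, Measure.finsetSum_apply, tsum_eq_sum (s := K)]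
  · exact Finset.sum_congr rfl fun x hx => by rw [if_pos hx]
  · intro x hx; rw [if_neg hx]; rfl

/-- Shift of time by one unit. -/
def shift {d : ℕ} (w : RawPath d) : RawPath d := fun n => w (n + 1)

lemma measurable_shift {d : ℕ} : Measurable (shift (d := d)) := by
  unfold shift; fun_prop

/-- Two-sided sequence of increments from two one-sided sequences. -/
def joinSteps {d : ℕ} (p : (ℕ → Site d) × (ℕ → Site d)) : ℤ → Site d :=
  fun n => if 0 ≤ n then p.1 n.toNat else -p.2 (-n - 1).toNat

/-- Two-sided path with initial point and two-sided sequence of increments. -/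
def biPath {d : ℕ} (p : (Site d × (ℤ → Site d)) × (ℤ → ℝ)) : RawPath d :=
  fun n => (p.1.1 + (if 0 ≤ n then ∑ k ∈ Finset.range n.toNat, p.1.2 k
    else -∑ k ∈ Finset.range (-n).toNat, p.1.2 (-k - 1)), p.2 n)

lemma measurable_biPath {d : ℕ} : Measurable (biPath (d := d)) := by
  refine measurable_pi_iff.2 fun n => ?_
  unfold biPath
  split_ifs <;> fun_prop

lemma measurable_joinSteps {d : ℕ} : Measurable (joinSteps (d := d)) := by
  refine measurable_pi_iff.2 fun n => ?_
  unfold joinSteps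
  split_ifs <;> fun_prop

lemma map_neg_stepLaw (d : ℕ) : (stepLaw d).map (fun x => -x) = stepLaw d := by
  have hm : Measurable fun x : Site d => -x := measurable_neg
  unfold stepLaw
  rw [Measure.map_smul]
  congr 1
  ext A hA
  rw [Measure.map_apply hm hA]
  simp only [Measure.finsetSum_apply, Measure.add_apply]
  refine Finset.sum_congr rfl fun i _ => ?_
  rw [Measure.dirac_apply' _ (hm hA), Measure.dirac_apply' _ (hm hA), Measure.dirac_apply' _ hA,
    Measure.dirac_apply' _ hA, add_comm]
  have e (y : Site d) : ((fun x : Site d => -x) ⁻¹' A).indicator (1 : Site d → ℝ≥0∞) y =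
      A.indicator 1 (-y) := rfl
  rw [e, e, neg_neg]

lemma map_joinSteps (d : ℕ) [NeZero d] :
    ((Measure.infinitePi fun _ : ℕ => stepLaw d).prod
      (Measure.infinitePi fun _ : ℕ => stepLaw d)).map joinSteps =
    Measure.infinitePi fun _ : ℤ => stepLaw d := by
  classical
  refine Measure.eq_infinitePi _ fun s t ht => ?_
  rw [Measure.map_apply measurable_joinSteps (.pi s.countable_toSet fun _ _ => ht _)]
  set s1 := (s.filter (0 ≤ ·)).image Int.toNat with hs1
  set s2 := (s.filter (¬ 0 ≤ ·)).image (fun n : ℤ => (-n - 1).toNat) with hs2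
  have hpre : joinSteps ⁻¹' ((s : Set ℤ).pi t) =
      ((s1 : Set ℕ).pi fun n => t n) ×ˢ
        ((s2 : Set ℕ).pi fun n => (fun x => -x) ⁻¹' t (-n - 1)) := by
    ext p
    simp only [Set.mem_preimage, Set.mem_pi, Set.mem_prod, Finset.mem_coe, hs1, hs2,
      Finset.mem_image, Finset.mem_filter, joinSteps]
    constructor
    · intro h
      refine ⟨?_, ?_⟩
      · rintro _ ⟨n, ⟨hn, hn0⟩, rfl⟩
        have := h n hn
        rw [if_pos hn0] at this
        rwa [Int.toNat_of_nonneg hn0]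
      · rintro _ ⟨n, ⟨hn, hn0⟩, rfl⟩
        have := h n hn
        rw [if_neg hn0] at this
        rw [Int.toNat_of_nonneg (by omega)]
        simpa using this
    · rintro ⟨h1, h2⟩ n hn
      split_ifs with hn0
      · have := h1 n.toNat ⟨n, ⟨hn, hn0⟩, rfl⟩
        rwa [Int.toNat_of_nonneg hn0] at this
      · have := h2 (-n - 1).toNat ⟨n, ⟨hn, hn0⟩, rfl⟩
        rw [Int.toNat_of_nonneg (by omega)] at this
        simpa using this
  rw [hpre, Measure.prod_prod, Measure.infinitePi_pi _ fun i _ => ht _,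
    Measure.infinitePi_pi _ fun i _ => measurable_neg (ht _),
    ← Finset.prod_filter_mul_prod_filter_not s (0 ≤ ·), hs1, hs2,
    Finset.prod_image, Finset.prod_image]
  · congr 1
    · refine Finset.prod_congr rfl fun n hn => ?_
      rw [Int.toNat_of_nonneg (Finset.mem_filter.1 hn).2]
    · refine Finset.prod_congr rfl fun n hn => ?_
      rw [Int.toNat_of_nonneg (by have := (Finset.mem_filter.1 hn).2; omega)]
      rw [← Measure.map_apply measurable_neg (ht _), map_neg_stepLaw]
      simp
  · intro a ha b hb hab
    have := (Finset.mem_filter.1 ha).2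
    have := (Finset.mem_filter.1 hb).2
    simp only at hab; omega
  · intro a ha b hb hab
    have := (Finset.mem_filter.1 ha).2
    have := (Finset.mem_filter.1 hb).2
    omega

lemma twoSided_eq (d : ℕ) [NeZero d] :
    twoSided d = ((Measure.count.prod (Measure.infinitePi fun _ : ℤ => stepLaw d)).prod
      (Measure.infinitePi fun _ : ℤ => expMeasure 1)).map biPath := by
  have h (x : Site d) : (((walkLaw x).prod (walkLaw x)).prod
      (Measure.infinitePi fun _ : ℤ => expMeasure 1)).map glue =
      (((Measure.dirac x).prod (Measure.infinitePi fun _ : ℤ => stepLaw d)).prod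
      (Measure.infinitePi fun _ : ℤ => expMeasure 1)).map biPath := by
    rw [Measure.dirac_prod, ← map_joinSteps, Measure.map_map (by fun_prop) measurable_joinSteps]
    unfold walkLaw
    rw [Measure.map_prod_map _ _ (measurable_walkPath x) (measurable_walkPath x)]
    conv_lhs => rw [← Measure.map_id (μ := Measure.infinitePi fun _ : ℤ => expMeasure 1)]
    conv_rhs => rw [← Measure.map_id (μ := Measure.infinitePi fun _ : ℤ => expMeasure 1)]
    have hm1 : Measurable (Prod.map (walkPath x) (walkPath x)) :=
      (measurable_walkPath x).prodMap (measurable_walkPath x)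
    have hm2 : Measurable (Prod.mk x ∘ joinSteps (d := d)) :=
      measurable_prodMk_left.comp measurable_joinSteps
    rw [Measure.map_prod_map _ _ hm1 measurable_id, Measure.map_prod_map _ _ hm2 measurable_id,
      Measure.map_map measurable_glue (hm1.prodMap measurable_id),
      Measure.map_map measurable_biPath (hm2.prodMap measurable_id)]
    congr 1
    funext p n
    simp only [Function.comp, glue, biPath, Prod.map, id, walkPath, joinSteps]
    split_ifs with hn
    · simp
    · congr 2
      rw [← Finset.sum_neg_distrib]
      refine Finset.sum_congr rfl fun k _ => ?_
      rw [if_neg (by omega), neg_neg]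
      rw [show (-(-(k : ℤ) - 1) - 1).toNat = k by omega]
  unfold twoSided
  simp_rw [h]
  rw [Measure.count, Measure.prod_sum_left, Measure.prod_sum_left,
    Measure.map_sum measurable_biPath.aemeasurable]

lemma measurePreserving_shift (d : ℕ) [NeZero d] :
    MeasurePreserving (shift (d := d)) (twoSided d) (twoSided d) := by
  refine ⟨measurable_shift, ?_⟩
  have hshift {X : Type} [MeasurableSpace X] (μ : Measure X) [IsProbabilityMeasure μ] :
      MeasurePreserving (fun (f : ℤ → X) n => f (n + 1)) (Measure.infinitePi fun _ : ℤ => μ)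
        (Measure.infinitePi fun _ : ℤ => μ) := by
    refine ⟨by fun_prop, ?_⟩
    have := Measure.infinitePi_map_piCongrLeft (fun _ : ℤ => μ) (Equiv.subRight (1 : ℤ))
    refine Eq.trans ?_ this
    congr 1
    funext f n
    have := Equiv.piCongrLeft_apply (fun _ : ℤ => X) (Equiv.subRight (1 : ℤ)) f n
    rw [MeasurableEquiv.coe_piCongrLeft, this]
    simp
  have h1 : MeasurePreserving
      (fun p : Site d × (ℤ → Site d) => (p.1 + p.2 0, fun n => p.2 (n + 1)))
      (Measure.count.prod (Measure.infinitePi fun _ : ℤ => stepLaw d))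
      (Measure.count.prod (Measure.infinitePi fun _ : ℤ => stepLaw d)) := by
    have h2 : MeasurePreserving
        (fun p : (ℤ → Site d) × Site d => ((fun n => p.1 (n + 1)), p.2 + p.1 0))
        ((Measure.infinitePi fun _ : ℤ => stepLaw d).prod Measure.count)
        ((Measure.infinitePi fun _ : ℤ => stepLaw d).prod Measure.count) := by
      refine (hshift (stepLaw d)).skew_product
        (g := fun (ζ : ℤ → Site d) (x : Site d) => x + ζ 0) (by fun_prop) (ae_of_all _ fun ζ => ?_)
      exact (measurePreserving_add_right Measure.count (ζ 0)).map_eq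
    exact (Measure.measurePreserving_swap.comp h2).comp Measure.measurePreserving_swap
  have h3 := h1.prod (hshift (expMeasure 1))
  rw [twoSided_eq, Measure.map_map measurable_shift measurable_biPath]
  conv_rhs => rw [← h3.map_eq]
  rw [Measure.map_map measurable_biPath h3.measurable]
  congr 1
  funext p n
  simp only [Function.comp, shift, biPath, Prod.map]
  refine Prod.ext ?_ rfl
  simp only
  by_cases hn : 0 ≤ n
  · rw [if_pos (by omega), if_pos hn, show (n + 1).toNat = n.toNat + 1 by omega,
      Finset.sum_range_succ']
    push_cast
    simp only [add_assoc]
    congr 1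
    rw [add_comm]
  · rw [if_neg hn]
    rcases eq_or_lt_of_le (show n + 1 ≤ 0 by omega) with h | h
    · rw [if_pos (by omega), h, show (-n).toNat = 1 by omega]
      simp
    · rw [if_neg (by omega), show (-n).toNat = (-(n + 1)).toNat + 1 by omega,
        Finset.sum_range_succ']
      simp only [Nat.cast_add, Nat.cast_one, Nat.cast_zero]
      have : ∀ k : ℕ, p.1.2 (-((k : ℤ) + 1) - 1 + 1) = p.1.2 (-k - 1) := fun k => by
        rw [show (-((k : ℤ) + 1) - 1 + 1) = -k - 1 by omega]
      simp only [this]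
      simp

lemma firstAt_shift {d : ℕ} (K : Finset (Site d)) (k : ℤ) :
    shift ⁻¹' firstAt K k = firstAt K (k + 1) := by
  ext w
  simp only [Set.mem_preimage, firstAt]
  refine and_congr_right fun _ => ⟨fun h n hn => ?_, fun h n hn => h _ (by omega)⟩
  have := h (n - 1) (by omega)
  rwa [shift, sub_add_cancel] at this

lemma firstAt_disjoint {d : ℕ} (K : Finset (Site d)) :
    Pairwise (fun j k => Disjoint (firstAt K j) (firstAt K k)) := by
  intro j k hjk
  rw [Set.disjoint_left]
  rintro w ⟨h1, h2⟩ ⟨h3, h4⟩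
  rcases lt_or_gt_of_ne hjk with h | h
  · exact h4 _ h h1
  · exact h2 _ h h3

lemma exists_firstAt {d : ℕ} (K : Finset (Site d)) {w : RawPath d} (hw : w ∈ pathSet d)
    (h : ∃ n, (w n).1 ∈ K) : ∃ k, w ∈ firstAt K k := by
  have hf : {n : ℤ | (w n).1 ∈ K}.Finite := by
    have : {n : ℤ | (w n).1 ∈ K} = ⋃ x ∈ K, {n : ℤ | (w n).1 = x} := by ext; simp
    rw [this]
    exact K.finite_toSet.biUnion fun x _ => hw.2.1 x
  obtain ⟨k, hk, hmin⟩ := hf.exists_minimalFor id _ h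
  refine ⟨k, hk, fun n hn hnK => ?_⟩
  have := hmin hnK hn.le
  simp at this
  omega

lemma twoSided_firstAt_congr {d : ℕ} [NeZero d] (K K' : Finset (Site d)) {B : Set (RawPath d)}
    (hB : MeasurableSet B) (hs : shift ⁻¹' B = B) (hK : ∀ w ∈ B, ∃ k, w ∈ firstAt K k)
    (hK' : ∀ w ∈ B, ∃ k, w ∈ firstAt K' k) :
    twoSided d (firstAt K 0 ∩ B) = twoSided d (firstAt K' 0 ∩ B) := by
  set m : ℤ → ℤ → ℝ≥0∞ := fun a b => twoSided d (firstAt K a ∩ firstAt K' b ∩ B) with hm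
  have hme (a b : ℤ) : MeasurableSet (firstAt K a ∩ firstAt K' b ∩ B) :=
    ((measurableSet_firstAt K a).inter (measurableSet_firstAt K' b)).inter hB
  have hstep (a b : ℤ) : m (a + 1) (b + 1) = m a b := by
    rw [hm]
    simp only
    rw [← (measurePreserving_shift d).measure_preimage (hme a b).nullMeasurableSet,
      Set.preimage_inter, Set.preimage_inter, firstAt_shift, firstAt_shift, hs]
  have hinv (b j : ℤ) : m j (b + j) = m 0 b := by
    induction j using Int.induction_on with
    | zero => simp
    | succ i ih => rw [← add_assoc, hstep, ih]
    | pred i ih => rw [← ih, ← hstep]; congr 1 <;> ring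
  have h1 : twoSided d (firstAt K 0 ∩ B) = ∑' k, m 0 k := by
    rw [hm, ← measure_iUnion]
    · congr 1
      ext w
      simp only [Set.mem_inter_iff, Set.mem_iUnion]
      exact ⟨fun h => (hK' w h.2).imp fun k hk => ⟨⟨h.1, hk⟩, h.2⟩,
        fun ⟨k, h⟩ => ⟨h.1.1, h.2⟩⟩
    · intro j k hjk
      exact (firstAt_disjoint K' hjk).mono (fun w h => h.1.2) (fun w h => h.1.2)
    · exact fun k => hme 0 k
  have h2 : twoSided d (firstAt K' 0 ∩ B) = ∑' k, m k 0 := by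
    rw [hm, ← measure_iUnion]
    · congr 1
      ext w
      simp only [Set.mem_inter_iff, Set.mem_iUnion]
      exact ⟨fun h => (hK w h.2).imp fun k hk => ⟨⟨hk, h.1⟩, h.2⟩,
        fun ⟨k, h⟩ => ⟨h.1.2, h.2⟩⟩
    · intro j k hjk
      exact (firstAt_disjoint K hjk).mono (fun w h => h.1.1) (fun w h => h.1.1)
    · exact fun k => hme k 0
  rw [h1, h2, ← (Equiv.neg ℤ).tsum_eq fun k => m k 0]
  refine tsum_congr fun k => ?_
  rw [← hinv k (-k)]
  simp

lemma measurableSet_pathSet (d : ℕ) : MeasurableSet (pathSet d) := by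
  have hσ (n : ℤ) : Measurable fun w : RawPath d => ENNReal.ofReal (w n).2 := by fun_prop
  have h1 : MeasurableSet {w : RawPath d | ∀ n, IsNeighbor (w n).1 (w (n + 1)).1} := by
    have : {w : RawPath d | ∀ n, IsNeighbor (w n).1 (w (n + 1)).1} = ⋂ n : ℤ,
        (fun w : RawPath d => ((w n).1, (w (n + 1)).1)) ⁻¹'
          {p : Site d × Site d | IsNeighbor p.1 p.2} := by ext; simp
    rw [this]
    exact .iInter fun n => (by fun_prop : Measurable fun w : RawPath d =>
      ((w n).1, (w (n + 1)).1)) (Set.to_countable _).measurableSet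
  have h2 : MeasurableSet {w : RawPath d | ∀ x : Site d, {n : ℤ | (w n).1 = x}.Finite} := by
    have : {w : RawPath d | ∀ x : Site d, {n : ℤ | (w n).1 = x}.Finite} = ⋂ x : Site d,
        ⋃ F : Finset ℤ, ⋂ n : ℤ, ⋂ _ : n ∉ F, {w : RawPath d | (w n).1 ∈ ({x}ᶜ : Set (Site d))} := by
      ext w
      simp only [Set.mem_iInter, Set.mem_iUnion, Set.mem_compl_iff, Set.mem_singleton_iff,
        Set.mem_ofPred_eq]
      refine forall_congr' fun x => ⟨fun h => ⟨h.toFinset, fun n hn => by simpa using hn⟩, ?_⟩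
      rintro ⟨F, hF⟩
      refine F.finite_toSet.subset fun n hn => ?_
      by_contra hnF
      exact hF n hnF hn
    rw [this]
    exact .iInter fun x => .iUnion fun F => .iInter fun n => .iInter fun _ => measurableSet_pos _ n
  have h3 : MeasurableSet {w : RawPath d | ∀ n, 0 < (w n).2} := by
    have : {w : RawPath d | ∀ n, 0 < (w n).2} = ⋂ n : ℤ, {w : RawPath d | 0 < (w n).2} := by
      ext; simp
    rw [this]
    exact .iInter fun n => measurableSet_lt measurable_const (by fun_prop)
  have h4 : MeasurableSet {w : RawPath d | (∑' n : ℕ, ENNReal.ofReal (w n).2) = ∞} :=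
    (Measurable.tsum fun n : ℕ => hσ n) (measurableSet_singleton _)
  have h5 : MeasurableSet {w : RawPath d | (∑' n : ℕ, ENNReal.ofReal (w (-n)).2) = ∞} :=
    (Measurable.tsum fun n : ℕ => hσ (-n)) (measurableSet_singleton _)
  exact h1.inter (h2.inter (h3.inter (h4.inter h5)))

lemma shift_preimage_pathSet (d : ℕ) : shift ⁻¹' pathSet d = pathSet d := by
  ext w
  have hall (p : ℤ → Prop) : (∀ n, p (n + 1)) ↔ ∀ n, p n :=
    ⟨fun h n => by simpa using h (n - 1), fun h n => h _⟩
  have hfin (x : Site d) : {n : ℤ | (w (n + 1)).1 = x}.Finite ↔ {n : ℤ | (w n).1 = x}.Finite := by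
    refine ⟨fun h => ?_, fun h => h.preimage (f := fun n : ℤ => n + 1)
      (add_left_injective 1).injOn⟩
    exact Set.finite_of_finite_preimage (f := fun n : ℤ => n + 1) h
      (fun n _ => ⟨n - 1, by simp⟩)
  have hfor : (∑' n : ℕ, ENNReal.ofReal (w (n + 1)).2) = ∞ ↔
      (∑' n : ℕ, ENNReal.ofReal (w n).2) = ∞ := by
    rw [tsum_eq_zero_add' (f := fun n : ℕ => ENNReal.ofReal (w n).2) ENNReal.summable]
    simp
  have hback : (∑' n : ℕ, ENNReal.ofReal (w (-n + 1)).2) = ∞ ↔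
      (∑' n : ℕ, ENNReal.ofReal (w (-n)).2) = ∞ := by
    rw [tsum_eq_zero_add' (f := fun n : ℕ => ENNReal.ofReal (w (-n + 1)).2) ENNReal.summable]
    simp
  simp only [Set.mem_preimage, pathSet, Set.mem_ofPred_eq, shift]
  rw [hall (fun n => IsNeighbor (w n).1 (w (n + 1)).1), hall (fun n => 0 < (w n).2), hfor, hback]
  simp only [hfin]

/-- All trajectories in a set of trajectories modulo time shift. -/
def lift {d : ℕ} (A : Set (PathMod d)) : Set (RawPath d) := Subtype.val '' (proj d ⁻¹' A)

lemma measurable_proj (d : ℕ) : Measurable (proj d) := measurable_quotient_mk'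

lemma measurableSet_lift {d : ℕ} {A : Set (PathMod d)} (hA : MeasurableSet A) :
    MeasurableSet (lift A) :=
  (measurableSet_pathSet d).subtype_image (measurable_proj d hA)

lemma shift_preimage_lift {d : ℕ} (A : Set (PathMod d)) : shift ⁻¹' lift A = lift A := by
  have key (v v' : Path d) (h : v'.1 = shift v.1) : proj d v' = proj d v :=
    Quotient.sound ⟨1, fun n => by rw [h]; rfl⟩
  ext w
  constructor
  · rintro ⟨v, hv, hvw⟩
    have hw : w ∈ pathSet d := by
      rw [← shift_preimage_pathSet, Set.mem_preimage, ← hvw]; exact v.2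
    refine ⟨⟨w, hw⟩, ?_, rfl⟩
    rw [Set.mem_preimage, ← key ⟨w, hw⟩ v hvw]
    exact hv
  · rintro ⟨v, hv, rfl⟩
    have hw : shift v.1 ∈ pathSet d := by
      rw [← Set.mem_preimage, shift_preimage_pathSet]; exact v.2
    refine ⟨⟨_, hw⟩, ?_, rfl⟩
    rw [Set.mem_preimage, key v ⟨_, hw⟩ rfl]
    exact hv

lemma mem_enters {d : ℕ} (K : Finset (Site d)) (w : Path d) :
    proj d w ∈ enters K ↔ ∃ n, (w.1 n).1 ∈ K := by
  constructor
  · rintro ⟨v, ⟨n, hn⟩, hvw⟩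
    obtain ⟨k, hk⟩ := Quotient.exact hvw
    exact ⟨n + k, by rwa [← hk n]⟩
  · exact fun h => ⟨w, h, rfl⟩

lemma measurableSet_enters {d : ℕ} (K : Finset (Site d)) : MeasurableSet (enters K) := by
  refine measurableSet_quotient.2 ?_
  have : (Quotient.mk'' : Path d → PathMod d) ⁻¹' enters K =
      ⋃ n : ℤ, Subtype.val ⁻¹' {w : RawPath d | (w n).1 ∈ (K : Set (Site d))} := by
    ext w
    simp only [Set.mem_iUnion]
    exact mem_enters K w
  rw [this]
  exact .iUnion fun n => measurable_subtype_coe (measurableSet_pos _ n)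

lemma map_entranceMeasure_apply {d : ℕ} [NeZero d] (K : Finset (Site d)) {A : Set (PathMod d)}
    (hA : MeasurableSet A) :
    (entranceMeasure K).map (proj d) A = twoSided d (firstAt K 0 ∩ lift A) := by
  rw [Measure.map_apply (measurable_proj d) hA, entranceMeasure,
    (MeasurableEmbedding.subtype_coe (measurableSet_pathSet d)).comap_apply, rawQ_eq_restrict]
  change (twoSided d).restrict (firstAt K 0) (lift A) = _
  rw [Measure.restrict_apply (measurableSet_lift hA), Set.inter_comm]

lemma map_entranceMeasure_congr {d : ℕ} [NeZero d] {K K' : Finset (Site d)} {A : Set (PathMod d)}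
    (hA : MeasurableSet A) (hK : A ⊆ enters K) (hK' : A ⊆ enters K') :
    (entranceMeasure K).map (proj d) A = (entranceMeasure K').map (proj d) A := by
  rw [map_entranceMeasure_apply K hA, map_entranceMeasure_apply K' hA]
  refine twoSided_firstAt_congr K K' (measurableSet_lift hA) (shift_preimage_lift A) ?_ ?_
  · rintro _ ⟨v, hv, rfl⟩
    exact exists_firstAt K v.2 ((mem_enters K v).1 (hK hv))
  · rintro _ ⟨v, hv, rfl⟩
    exact exists_firstAt K' v.2 ((mem_enters K' v).1 (hK' hv))

lemma map_entranceMeasure_inter {d : ℕ} [NeZero d] (K : Finset (Site d)) {A : Set (PathMod d)}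
    (hA : MeasurableSet A) :
    (entranceMeasure K).map (proj d) (A ∩ enters K) = (entranceMeasure K).map (proj d) A := by
  rw [map_entranceMeasure_apply K hA, map_entranceMeasure_apply K (hA.inter (measurableSet_enters K))]
  congr 1
  ext w
  constructor
  · rintro ⟨h, v, hv, rfl⟩
    exact ⟨h, v, hv.1, rfl⟩
  · rintro ⟨h, v, hv, rfl⟩
    exact ⟨h, v, ⟨hv, (mem_enters K v).2 ⟨0, h.1⟩⟩, rfl⟩

lemma enters_mono {d : ℕ} {K K' : Finset (Site d)} (h : K ⊆ K') : enters K ⊆ enters K' := by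
  rintro _ ⟨w, ⟨n, hn⟩, rfl⟩
  exact ⟨w, ⟨n, h hn⟩, rfl⟩

theorem isIntensity_intensity (d : ℕ) [NeZero d] : IsIntensity (intensity d) := by
  classical
  intro K
  set m : Finset (Site d) → Measure (PathMod d) := fun K => (entranceMeasure K).map (proj d) with hm
  have hmK (K : Finset (Site d)) : (m K).restrict (enters K) = m K := by
    ext A hA
    rw [Measure.restrict_apply hA, hm]
    exact map_entranceMeasure_inter K hA
  have hle (K' : Finset (Site d)) :
      m K' ≤ m K + (⊤ : ℝ≥0∞) • Measure.count.restrict (enters K)ᶜ := by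
    refine Measure.le_iff.2 fun A hA => ?_
    rw [← measure_inter_add_sdiff A (measurableSet_enters K), Measure.add_apply]
    refine add_le_add ?_ ?_
    · have hAK := hA.inter (measurableSet_enters K)
      calc m K' (A ∩ enters K) = m K' (A ∩ enters K ∩ enters K') :=
            (map_entranceMeasure_inter K' hAK).symm
        _ = m K (A ∩ enters K ∩ enters K') :=
            map_entranceMeasure_congr (hAK.inter (measurableSet_enters K'))
              Set.inter_subset_right (fun w h => h.1.2)
        _ ≤ m K A := measure_mono fun w h => h.1.1
    · rw [Measure.smul_apply, Measure.restrict_apply hA, ← Set.sdiff_eq]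
      rcases Set.eq_empty_or_nonempty (A \ enters K) with h | h
      · simp [h]
      · rw [smul_eq_mul, ENNReal.top_mul (Measure.count_ne_zero h)]
        exact le_top
  refine le_antisymm ?_ ?_
  · refine (Measure.restrict_mono le_rfl (iSup_le hle)).trans ?_
    rw [Measure.restrict_add, hmK, Measure.restrict_smul,
      Measure.restrict_restrict (measurableSet_enters K)]
    simp [hm]
  · calc m K = (m K).restrict (enters K) := (hmK K).symm
      _ ≤ _ := Measure.restrict_mono le_rfl (le_iSup m K)

/-- The intensity measure is characterized by its restrictions to the trajectories entering a
given finite set. -/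
theorem isIntensity_iff {d : ℕ} [NeZero d] (ν : Measure (PathMod d)) :
    IsIntensity ν ↔ ν = intensity d := by
  refine ⟨fun h => ?_, fun h => h ▸ isIntensity_intensity d⟩
  have hU : ⋃ x : Site d, enters {x} = Set.univ := by
    refine Set.eq_univ_of_forall fun w => ?_
    obtain ⟨v, rfl⟩ := Quotient.exists_rep w
    exact Set.mem_iUnion.2 ⟨(v.1 0).1, (mem_enters _ v).2 ⟨0, by simp⟩⟩
  refine (Measure.ext_iff_of_iUnion_eq_univ hU).2 fun x => ?_
  rw [h, isIntensity_intensity d]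

lemma measurable_pathModTime {d : ℕ} (x : Site d) : Measurable (pathModTime x) := by
  refine measurable_from_quotient.2 ?_
  refine Measurable.tsum fun n => ?_
  have hn : Measurable fun w : Path d => w.1 n := (measurable_pi_apply n).comp measurable_subtype_coe
  exact Measurable.ite ((measurable_fst.comp hn) (measurableSet_singleton x))
    (measurable_snd.comp hn).ennreal_ofReal measurable_const

/-- For a point measure, `L_{x,u}` is the sum over all points with label at most `u` and all times
`n` with `Xₙ = x` of the holding times. -/
theorem occupation_sum_dirac {d : ℕ} {ι : Type*} (w : ι → Path d) (v : ι → ℝ≥0) (x : Site d)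
    (u : ℝ) :
    occupation (Measure.sum fun i => Measure.dirac (proj d (w i), v i)) x u =
      ∑' (i : ι) (n : ℤ), if ((w i).1 n).1 = x ∧ (v i : ℝ) ≤ u
        then ENNReal.ofReal ((w i).1 n).2 else 0 := by
  have hf : Measurable fun p : PathMod d × ℝ≥0 =>
      if (p.2 : ℝ) ≤ u then pathModTime x p.1 else 0 :=
    Measurable.ite (measurableSet_le (by fun_prop) measurable_const)
      ((measurable_pathModTime x).comp measurable_fst) measurable_const
  rw [occupation, lintegral_sum_measure]
  refine tsum_congr fun i => ?_
  rw [lintegral_dirac' _ hf]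
  by_cases h : (v i : ℝ) ≤ u
  · simp only [h, if_true, and_true]
    rfl
  · simp [h]

end Interlacement

end

/-! Both limits are computed on characteristic functions. Let `T_x` be the total time a trajectory
spends at `x`, and put `F = ∑ a_i T_{z_i}`. Since `∑ a_i L_{z_i,u}` integrates `F` against the
Poisson points with label at most `u`, Campbell's formula gives `E exp(i ∑ a_i L_{z_i,u} / r) =
exp(u ∫ (e^{iF/r} - 1) dν)` (`IsPoissonPointProcess.integral_exp`,
`integral_exp_sum_occupationTime`). The asymptotics therefore depend only on the first two moments
of `F` under `ν`.

These follow from `∫ T_x dν = 1` and `∫ T_x T_y dν = 2 g(x,y)` (`lintegral_pathModTime`,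
`lintegral_pathModTime_mul`). The two-sided walk with counting measure as initial law is shift
invariant, so mass transport replaces "first visit to `x` at time 0, weighted by all the time spent
at `x`" by "at `x` at time 0, weighted by the holding time there"
(`setLIntegral_firstAt_tsum_stepTime`). Under the latter description both halves of the path are
unconditioned walks from `x`, and the moments are explicit sums.

With `r = u`, the exponent tends to `i ∫ F dν = i ∑ a_i`, the exponent for the constant field 1.
With `r = √(2u)` and `∑ a_i = 0`, the first order term vanishes and the second order term tends to
`-(1/4) ∫ F² dν = -(1/2) ∑ a_i a_j g(z_i, z_j)`, the Gaussian exponent. The condition `∑ a_i = 0`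
holds for combinations of differences with the value at the origin.

Transience (`tsum_walkLaw_lt_top`) makes `g` finite and lets the two-sided walk visit each site
finitely often. It is proved with an explicit superharmonic function. Passing from characteristic
functions to the whole field uses Lévy's continuity theorem on finite sets of sites and the
portmanteau theorem on open cylinders. -/

/-! ### Convergence in distribution of random elements of a countable product -/

/-- Restriction of a real sequence indexed by `ι` to finitely many coordinates. -/
def euclideanRestrict {ι : Type*} (S : Finset ι) (y : ι → ℝ) : EuclideanSpace ℝ S :=
  WithLp.toLp 2 fun i : S => y i

lemma continuous_euclideanRestrict {ι : Type*} (S : Finset ι) :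
    Continuous (euclideanRestrict S) := by
  unfold euclideanRestrict
  fun_prop

/-- An open set of real sequences is the increasing union of open cylinders. -/
lemma exists_open_cylinders {ι : Type*} {G : Set (ι → ℝ)} (hG : IsOpen G) :
    ∃ V : (S : Finset ι) → Set (EuclideanSpace ℝ S), (∀ S, IsOpen (V S)) ∧
      (Monotone fun S => euclideanRestrict S ⁻¹' V S) ∧ ⋃ S, euclideanRestrict S ⁻¹' V S = G := by
  -- `V S` is the largest open set whose cylinder lies in `G`. Maximality gives monotonicity: the
  -- pullback of an admissible set under the coordinate projection is again admissible.
  refine ⟨fun S => ⋃₀ {V | IsOpen V ∧ euclideanRestrict S ⁻¹' V ⊆ G},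
    fun S => isOpen_sUnion fun V hV => hV.1, ?_, ?_⟩
  · rintro S T hST x ⟨V, ⟨hV, hVG⟩, hx⟩
    let π : EuclideanSpace ℝ T → EuclideanSpace ℝ S := fun y =>
      WithLp.toLp 2 fun i : S => y ⟨i, hST i.2⟩
    have hπ : Continuous π := by fun_prop
    exact ⟨π ⁻¹' V, ⟨hV.preimage hπ, hVG⟩, hx⟩
  · refine Set.Subset.antisymm (Set.iUnion_subset fun S => ?_) fun x hx => ?_
    · rintro x ⟨V, ⟨_, hVG⟩, hx⟩
      exact hVG hx
    · obtain ⟨S, u, hu, hS⟩ := isOpen_pi_iff.1 hG x hx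
      have hV : IsOpen {y : EuclideanSpace ℝ S | ∀ i : S, y i ∈ u i} := by
        simp only [Set.ofPred_forall]
        exact isOpen_iInter_of_finite fun i => (hu i i.2).1.preimage (by fun_prop)
      refine Set.mem_iUnion.2 ⟨S, _, ⟨hV, fun y hy => hS fun i hi => hy ⟨i, hi⟩⟩,
        fun i => (hu i i.2).2⟩

/-- Convergence of the finite-dimensional marginals implies weak convergence of probability measures
on a countable product of real lines. -/
lemma tendsto_of_tendsto_map_euclideanRestrict {ι : Type*} [Countable ι]
    {μs : ℕ → ProbabilityMeasure (ι → ℝ)} {μ : ProbabilityMeasure (ι → ℝ)}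
    (h : ∀ S : Finset ι, Tendsto
      (fun n => (μs n).map (continuous_euclideanRestrict S).aemeasurable) atTop
      (nhds (μ.map (continuous_euclideanRestrict S).aemeasurable))) :
    Tendsto μs atTop (nhds μ) := by
  refine tendsto_of_forall_isOpen_le_liminf' fun G hG => ?_
  obtain ⟨V, hV, hmono, rfl⟩ := exists_open_cylinders hG
  -- Continuity from below reduces the open set criterion for weak convergence to cylinders over a
  -- fixed finite set of coordinates.
  rw [hmono.measure_iUnion]
  refine iSup_le fun S => ?_
  have hm := (continuous_euclideanRestrict S).measurable
  have h1 := ProbabilityMeasure.le_liminf_measure_open_of_tendsto (h S) (hV S)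
  simp only [ProbabilityMeasure.toMeasure_map] at h1
  rw [Measure.map_apply hm (hV S).measurableSet] at h1
  refine h1.trans (liminf_le_liminf (Eventually.of_forall fun n => ?_))
  rw [Measure.map_apply hm (hV S).measurableSet]
  exact measure_mono (Set.subset_iUnion (fun S => euclideanRestrict S ⁻¹' V S) S)

lemma charFun_map_euclideanRestrict {ι Ω : Type*} [Countable ι] [MeasurableSpace Ω] {P : Measure Ω}
    {X : Ω → ι → ℝ} (hX : AEMeasurable X P) (S : Finset ι) (t : EuclideanSpace ℝ S) :
    charFun ((P.map X).map (euclideanRestrict S)) t =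
      ∫ ω, Complex.exp ((∑ i : S, t i * X ω i : ℝ) * Complex.I) ∂P := by
  have hm := (continuous_euclideanRestrict S).measurable
  rw [AEMeasurable.map_map_of_aemeasurable hm.aemeasurable hX, charFun_apply,
    integral_map (hm.comp_aemeasurable hX) (by fun_prop)]
  simp only [Function.comp, euclideanRestrict, PiLp.inner_apply]
  rfl

/-- Random elements of a countable product of real lines converge in distribution if the
characteristic functions of the finite-dimensional marginals converge. -/
theorem tendstoInDistribution_pi_of_tendsto_charFun {ι Ω Ω' : Type*} [Countable ι]
    [MeasurableSpace Ω] {P : Measure Ω} [IsProbabilityMeasure P]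
    [MeasurableSpace Ω'] {P' : Measure Ω'} [IsProbabilityMeasure P']
    {X : ℝ → Ω → ι → ℝ} (hX : ∀ u, AEMeasurable (X u) P) {Z : Ω' → ι → ℝ} (hZ : AEMeasurable Z P')
    (h : ∀ (S : Finset ι) (t : S → ℝ), Tendsto
      (fun u => ∫ ω, Complex.exp ((∑ i : S, t i * X u ω i : ℝ) * Complex.I) ∂P) atTop
      (nhds (∫ ω, Complex.exp ((∑ i : S, t i * Z ω i : ℝ) * Complex.I) ∂P'))) :
    TendstoInDistribution X atTop Z (fun _ => P) P' where
  forall_aemeasurable := hX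
  aemeasurable_limit := hZ
  tendsto := by
    -- The level `u` is real, while the finite-dimensional criterion above is for sequences; the
    -- space of probability measures receives the limit along every sequence `x` tending to
    -- infinity.
    refine tendsto_of_seq_tendsto fun x hx => ?_
    refine tendsto_of_tendsto_map_euclideanRestrict fun S => ?_
    refine ProbabilityMeasure.tendsto_iff_tendsto_charFun.2 fun t => ?_
    have key := (h S t).comp hx
    rw [← charFun_map_euclideanRestrict hZ] at key
    exact key.congr fun n => (charFun_map_euclideanRestrict (hX (x n)) S t).symm

/-! ### Poisson point processes -/

lemma enorm_exp_mul_I_sub_exp_mul_I_le (a b : ℝ) :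
    ‖Complex.exp (a * Complex.I) - Complex.exp (b * Complex.I)‖ₑ ≤ ‖a - b‖ₑ := by
  have h : Complex.exp (a * Complex.I) - Complex.exp (b * Complex.I) =
      Complex.exp (b * Complex.I) * (Complex.exp (Complex.I * (a - b : ℝ)) - 1) := by
    rw [mul_sub, ← Complex.exp_add, mul_one]
    congr 2
    push_cast
    ring
  rw [h, enorm_mul]
  have h1 : ‖Complex.exp (b * Complex.I)‖ₑ = 1 := by
    rw [← ofReal_norm, Complex.norm_exp_ofReal_mul_I, ENNReal.ofReal_one]
  rw [h1, one_mul]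
  exact Real.enorm_exp_I_mul_ofReal_sub_one_le

/-- The term `n = 0` vanishes, and `n * r ^ n / n!` equals `r` times the Poisson weight with index
`n - 1`, whose total mass is 1. -/
lemma lintegral_natCast_poissonMeasure (r : ℝ≥0) :
    ∫⁻ n : ℕ, (n : ℝ≥0∞) ∂(poissonMeasure r) = r := by
  have h : HasSum (fun n : ℕ => (n : ℝ) * (Real.exp (-r) * (r : ℝ) ^ n / n.factorial)) r := by
    rw [← hasSum_nat_add_iff' 1]
    have := (hasSum_one_poissonMeasure r).mul_left (r : ℝ)
    simp only [mul_one] at this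
    convert! this using 1
    · funext n
      rw [Nat.factorial_succ]
      push_cast
      field_simp
      ring
    · simp
  rw [lintegral_countable']
  have h2 (n : ℕ) : (n : ℝ≥0∞) * poissonMeasure r {n} =
      ENNReal.ofReal ((n : ℝ) * (Real.exp (-r) * (r : ℝ) ^ n / n.factorial)) := by
    rw [poissonMeasure_singleton, ENNReal.ofReal_mul (by positivity), ENNReal.ofReal_natCast]
  simp_rw [h2]
  rw [← ENNReal.ofReal_tsum_of_nonneg (fun n => by positivity) h.summable, h.tsum_eq]
  simp

namespace Interlacement

variable {Ω E : Type*} [MeasurableSpace Ω] [MeasurableSpace E] {N : Ω → Measure E} {μ : Measure E}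
  {P : Measure Ω}

lemma IsPoissonPointProcess.lintegral_apply [IsProbabilityMeasure P]
    (hN : IsPoissonPointProcess N μ P) {A : Set E}
    (hA : MeasurableSet A) : ∫⁻ ω, N ω A ∂P = μ A := by
  by_cases h : μ A = ∞
  · rw [lintegral_congr_ae (hN.infinite A hA h), lintegral_const, h, measure_univ, mul_one]
  · rw [(hN.poisson A hA h).lintegral_comp (f := fun x => x) (by fun_prop),
      lintegral_map (by fun_prop) .of_discrete, lintegral_natCast_poissonMeasure,
      ENNReal.coe_toNNReal h]

/-- The mean measure of a Poisson point process is its intensity measure. -/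
lemma IsPoissonPointProcess.bind_eq [IsProbabilityMeasure P]
    (hN : IsPoissonPointProcess N μ P) : P.bind N = μ := by
  ext A hA
  rw [Measure.bind_apply hA hN.measurable.aemeasurable, hN.lintegral_apply hA]

lemma IsPoissonPointProcess.lintegral_lintegral [IsProbabilityMeasure P]
    (hN : IsPoissonPointProcess N μ P) {f : E → ℝ≥0∞} (hf : Measurable f) :
    ∫⁻ ω, ∫⁻ x, f x ∂N ω ∂P = ∫⁻ x, f x ∂μ := by
  rw [← hN.bind_eq, Measure.lintegral_bind hN.measurable.aemeasurable hf.aemeasurable]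

lemma IsPoissonPointProcess.ae_lintegral_lt_top [IsProbabilityMeasure P]
    (hN : IsPoissonPointProcess N μ P) {f : E → ℝ≥0∞} (hf : Measurable f)
    (h : ∫⁻ x, f x ∂μ ≠ ∞) : ∀ᵐ ω ∂P, ∫⁻ x, f x ∂N ω < ∞ :=
  ae_lt_top ((Measure.measurable_lintegral hf).comp hN.measurable)
    (by rwa [hN.lintegral_lintegral hf])

lemma IsPoissonPointProcess.ae_integrable [IsProbabilityMeasure P]
    (hN : IsPoissonPointProcess N μ P) {f : E → ℝ} (hf : Measurable f)
    (h : Integrable f μ) : ∀ᵐ ω ∂P, Integrable f (N ω) := by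
  filter_upwards [hN.ae_lintegral_lt_top hf.enorm h.2.ne] with ω hω
  exact ⟨hf.aestronglyMeasurable, hω⟩

/-- Almost surely `f` is integrable for the realization, and then its integral is a difference of
two lower integrals, each measurable in `ω`. -/
lemma IsPoissonPointProcess.aemeasurable_integral [IsProbabilityMeasure P]
    (hN : IsPoissonPointProcess N μ P) {f : E → ℝ} (hf : Measurable f)
    (h : Integrable f μ) : AEMeasurable (fun ω => ∫ x, f x ∂N ω) P := by
  have h1 : Measurable fun ω => (∫⁻ x, ENNReal.ofReal (f x) ∂N ω).toReal -
      (∫⁻ x, ENNReal.ofReal (-f x) ∂N ω).toReal :=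
    (((Measure.measurable_lintegral hf.ennreal_ofReal).comp hN.measurable).ennreal_toReal).sub
      (((Measure.measurable_lintegral hf.neg.ennreal_ofReal).comp hN.measurable).ennreal_toReal)
  refine ⟨_, h1, ?_⟩
  filter_upwards [hN.ae_integrable hf h] with ω hω
  exact integral_eq_lintegral_pos_part_sub_lintegral_neg_part hω

lemma IsPoissonPointProcess.integral_exp_apply (hN : IsPoissonPointProcess N μ P) {A : Set E}
    (hA : MeasurableSet A) (hμ : μ A ≠ ∞) (c : ℝ) :
    ∫ ω, Complex.exp (((N ω).real A * c : ℝ) * Complex.I) ∂P =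
      Complex.exp (μ.real A * (Complex.exp (c * Complex.I) - 1)) := by
  have hm : Measurable fun x : ℝ≥0∞ => Complex.exp ((x.toReal * c : ℝ) * Complex.I) := by fun_prop
  have h1 := (hN.poisson A hA hμ).integral_comp hm.aestronglyMeasurable
  have h2 := charFun_map_cast_poissonMeasure (μ A).toNNReal c
  rw [charFun_apply, integral_map .of_discrete (by fun_prop)] at h2
  refine (h1.trans ?_).trans (h2.trans ?_)
  · rw [integral_map .of_discrete hm.aestronglyMeasurable]
    simp [mul_comm]
  · rfl

/-- The counts on the level sets of `f` are independent Poisson variables, so the characteristic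
function factorizes and the Poisson exponents add up. -/
lemma IsPoissonPointProcess.integral_exp_simpleFunc [IsProbabilityMeasure P]
    (hN : IsPoissonPointProcess N μ P)
    (f : SimpleFunc E ℝ) (hf : Integrable f μ) :
    ∫ ω, Complex.exp ((∫ x, f x ∂N ω : ℝ) * Complex.I) ∂P =
      Complex.exp (∫ x, (Complex.exp (f x * Complex.I) - 1) ∂μ) := by
  classical
  -- The level set of the value 0 may have infinite intensity; it contributes to neither side and is
  -- left out.
  set s : Finset ℝ := {y ∈ f.range | y ≠ 0} with hs
  let e := s.equivFin.symm
  let y : Fin s.card → ℝ := fun i => e i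
  let A : Fin s.card → Set E := fun i => f ⁻¹' {y i}
  have hA (i) : MeasurableSet (A i) := f.measurableSet_preimage _
  have hy (i) : y i ≠ 0 := (Finset.mem_filter.1 (e i).2).2
  have hμA (i) : μ (A i) ≠ ∞ := (f.measure_preimage_lt_top_of_integrable hf (hy i)).ne
  have hdisj : Pairwise fun i j => Disjoint (A i) (A j) := by
    intro i j hij
    refine Disjoint.preimage _ (Set.disjoint_singleton.2 fun h => hij ?_)
    exact e.injective (Subtype.ext h)
  have hsum {F : Type} [AddCommMonoid F] (g : ℝ → F) : ∑ x ∈ s, g x = ∑ i, g (y i) := by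
    rw [← Finset.sum_coe_sort]
    exact (Equiv.sum_comp e fun x : s => g x).symm
  have h1 : ∀ᵐ ω ∂P, Complex.exp ((∫ x, f x ∂N ω : ℝ) * Complex.I) =
      ∏ i, Complex.exp (((N ω (A i)).toReal * y i : ℝ) * Complex.I) := by
    filter_upwards [hN.ae_integrable f.measurable hf] with ω hω
    rw [← SimpleFunc.integral_eq_integral f hω, SimpleFunc.integral_eq_sum_filter, hsum,
      ← Complex.exp_sum, ← Finset.sum_mul, ← Complex.ofReal_sum]
    rfl
  have hm (i : Fin s.card) :
      Measurable fun x : ℝ≥0∞ => Complex.exp ((x.toReal * y i : ℝ) * Complex.I) := by fun_prop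
  rw [integral_congr_ae h1, (hN.indep _ A hA hdisj).integral_fun_prod_comp
    (f := fun i x => Complex.exp ((x.toReal * y i : ℝ) * Complex.I))
    (fun i => ((Measure.measurable_coe (hA i)).comp hN.measurable).aemeasurable)
    (fun i => (hm i).aestronglyMeasurable)]
  have h2 (i : Fin s.card) := hN.integral_exp_apply (hA i) (hμA i) (y i)
  simp only [Measure.real] at h2
  rw [Finset.prod_congr rfl fun i _ => h2 i, ← Complex.exp_sum]
  congr 1
  let g : ℝ → ℂ := fun x => Complex.exp (x * Complex.I) - 1
  have hg : g 0 = 0 := by simp [g]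
  have hfg : Integrable (f.map g) μ := by
    refine SimpleFunc.integrable_iff_finMeasSupp.2 ?_
    exact (SimpleFunc.integrable_iff_finMeasSupp.1 hf).map hg
  have h3 : ∫ x, (Complex.exp (f x * Complex.I) - 1) ∂μ = ∫ x, f.map g x ∂μ := rfl
  rw [h3, ← SimpleFunc.integral_eq_integral _ hfg, SimpleFunc.map_integral _ _ hf hg]
  rw [← Finset.sum_subset (Finset.filter_subset (fun y => y ≠ 0) f.range), ← hs, hsum]
  · refine Finset.sum_congr rfl fun i _ => ?_
    rw [Complex.real_smul]
    rfl
  · intro x hx hx'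
    have : x = 0 := by
      by_contra h
      exact hx' (Finset.mem_filter.2 ⟨hx, h⟩)
    rw [this, hg, smul_zero]

/-- Campbell's formula for the characteristic function of an integral with respect to a Poisson
point process. -/
theorem IsPoissonPointProcess.integral_exp [IsProbabilityMeasure P]
    (hN : IsPoissonPointProcess N μ P)
    {f : E → ℝ} (hfm : Measurable f) (hf : Integrable f μ) :
    ∫ ω, Complex.exp ((∫ x, f x ∂N ω : ℝ) * Complex.I) ∂P =
      Complex.exp (∫ x, (Complex.exp (f x * Complex.I) - 1) ∂μ) := by
  let F (n : ℕ) : SimpleFunc E ℝ := SimpleFunc.approxOn f hfm (Set.range f ∪ {0}) 0 (by simp) n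
  have hF (n) : Integrable (F n) μ := SimpleFunc.integrable_approxOn_range hfm hf n
  have hlim : Tendsto (fun n => ∫⁻ x, ‖F n x - f x‖ₑ ∂μ) atTop (nhds 0) :=
    SimpleFunc.tendsto_approxOn_range_L1_enorm hfm hf
  have hint {g : E → ℝ} (hgm : Measurable g) (hg : Integrable g μ) :
      Integrable (fun x => Complex.exp (g x * Complex.I) - 1) μ := by
    refine hg.mono (by fun_prop) (ae_of_all _ fun x => ?_)
    have := Real.norm_exp_I_mul_ofReal_sub_one_le (x := g x)
    rwa [mul_comm] at this
  have h1 : Tendsto (fun n => ∫ ω, Complex.exp ((∫ x, F n x ∂N ω : ℝ) * Complex.I) ∂P) atTop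
      (nhds (∫ ω, Complex.exp ((∫ x, f x ∂N ω : ℝ) * Complex.I) ∂P)) := by
    have hb {g : E → ℝ} (hgm : Measurable g) (hg : Integrable g μ) :
        Integrable (fun ω => Complex.exp ((∫ x, g x ∂N ω : ℝ) * Complex.I)) P := by
      have hm := hN.aemeasurable_integral hgm hg
      refine Integrable.of_bound (hm.complex_ofReal.mul_const _).cexp.aestronglyMeasurable 1
        (ae_of_all _ fun ω => ?_)
      rw [Complex.norm_exp_ofReal_mul_I]
    refine tendsto_integral_of_L1 _ (hb hfm hf).aestronglyMeasurable
      (Eventually.of_forall fun n => hb (F n).measurable (hF n)) ?_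
    refine tendsto_of_tendsto_of_tendsto_of_le_of_le tendsto_const_nhds hlim
      (fun n => zero_le) fun n => ?_
    have hd : Measurable fun x => ‖F n x - f x‖ₑ := ((F n).measurable.sub hfm).enorm
    change _ ≤ ∫⁻ x, ‖F n x - f x‖ₑ ∂μ
    -- Because the mean measure is `μ`, the `L¹(μ)` distance between `F n` and `f` is the expected
    -- `L¹(N ω)` distance, which bounds the change in the characteristic function.
    rw [← hN.lintegral_lintegral hd]
    refine lintegral_mono_ae ?_
    filter_upwards [hN.ae_integrable hfm hf, hN.ae_integrable (F n).measurable (hF n)] with ω h h'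
    refine (enorm_exp_mul_I_sub_exp_mul_I_le _ _).trans ?_
    rw [← integral_sub h' h]
    exact enorm_integral_le_lintegral_enorm _
  have h2 : Tendsto (fun n => ∫ x, (Complex.exp (F n x * Complex.I) - 1) ∂μ) atTop
      (nhds (∫ x, (Complex.exp (f x * Complex.I) - 1) ∂μ)) := by
    refine tendsto_integral_of_L1 _ (hint hfm hf).aestronglyMeasurable
      (Eventually.of_forall fun n => hint (F n).measurable (hF n)) ?_
    refine tendsto_of_tendsto_of_tendsto_of_le_of_le tendsto_const_nhds hlim
      (fun n => zero_le) fun n => lintegral_mono fun x => ?_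
    rw [sub_sub_sub_cancel_right]
    exact enorm_exp_mul_I_sub_exp_mul_I_le _ _
  refine tendsto_nhds_unique h1 ?_
  simp_rw [hN.integral_exp_simpleFunc _ (hF _)]
  exact (Complex.continuous_exp.tendsto _).comp h2

end Interlacement

/-! ### Transience of simple random walk -/

namespace Interlacement

variable {d : ℕ}

/-- One step of simple random walk applied to a nonnegative function. -/
noncomputable def walkStep (h : Site d → ℝ≥0∞) (x : Site d) : ℝ≥0∞ := ∫⁻ s, h (x + s) ∂stepLaw d

lemma walkStep_eq (h : Site d → ℝ≥0∞) (x : Site d) :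
    walkStep h x = (2 * d : ℝ≥0∞)⁻¹ *
      ∑ i : Fin d, (h (x + Pi.single i 1) + h (x + -Pi.single i 1)) := by
  simp [walkStep, stepLaw, lintegral_smul_measure, lintegral_finsetSum_measure,
    lintegral_add_measure]

lemma measurable_comp_eval (h : Site d → ℝ≥0∞) (n : ℕ) :
    Measurable fun f : ℕ → Site d => h (f n) :=
  (measurable_of_countable h).comp (measurable_pi_apply n)

variable [NeZero d]

lemma lintegral_walkLaw {x : Site d} {F : (ℕ → Site d) → ℝ≥0∞} (hF : Measurable F) :
    ∫⁻ f, F f ∂walkLaw x =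
      ∫⁻ ξ, F (walkPath x ξ) ∂(Measure.infinitePi fun _ : ℕ => stepLaw d) := by
  rw [walkLaw, lintegral_map hF (measurable_walkPath x)]

/-- Markov property at time `n`: the increment `ξ n` is independent of the sum of the earlier ones,
so it can be integrated first. -/
lemma lintegral_walkLaw_succ (h : Site d → ℝ≥0∞) (x : Site d) (n : ℕ) :
    ∫⁻ f, h (f (n + 1)) ∂walkLaw x = ∫⁻ f, walkStep h (f n) ∂walkLaw x := by
  rw [lintegral_walkLaw (measurable_comp_eval h (n + 1)),
    lintegral_walkLaw (measurable_comp_eval (walkStep h) n)]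
  set Q := Measure.infinitePi fun _ : ℕ => stepLaw d with hQ
  have hind : iIndepFun (fun (k : ℕ) (ξ : ℕ → Site d) => ξ k) Q :=
    iIndepFun_infinitePi (P := fun _ : ℕ => stepLaw d) (X := fun _ s => s) fun _ => measurable_id
  have h1 : IndepFun (fun ξ : ℕ → Site d => ∑ k ∈ Finset.range n, ξ k) (fun ξ => ξ n) Q := by
    have := hind.indepFun_finsetSum_of_notMem (fun k => measurable_pi_apply k)
      (s := Finset.range n) (i := n) (by simp)
    convert! this using 1
    ext ξ i
    simp
  have hlaw : Q.map (fun ξ => ξ n) = stepLaw d :=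
    Measure.infinitePi_map_eval (fun _ : ℕ => stepLaw d) n
  have hm1 : Measurable fun ξ : ℕ → Site d => ∑ k ∈ Finset.range n, ξ k := by fun_prop
  have h2 := (indepFun_iff_map_prod_eq_prod_map_map hm1.aemeasurable
    (measurable_pi_apply n).aemeasurable).1 h1
  have hg : Measurable fun p : Site d × Site d => h (x + p.1 + p.2) := measurable_of_countable _
  calc ∫⁻ ξ, h (walkPath x ξ (n + 1)) ∂Q
      = ∫⁻ ξ, (fun p : Site d × Site d => h (x + p.1 + p.2))
          (∑ k ∈ Finset.range n, ξ k, ξ n) ∂Q := by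
        refine lintegral_congr fun ξ => ?_
        simp [walkPath, Finset.sum_range_succ, add_assoc]
    _ = ∫⁻ p, h (x + p.1 + p.2)
          ∂((Q.map fun ξ => ∑ k ∈ Finset.range n, ξ k).prod (stepLaw d)) := by
        rw [← hlaw, ← h2, lintegral_map hg (hm1.prodMk (measurable_pi_apply n))]
    _ = ∫⁻ ξ, walkStep h (walkPath x ξ n) ∂Q := by
        rw [lintegral_prod _ hg.aemeasurable, lintegral_map (measurable_of_countable _) hm1]
        rfl

lemma walkLaw_zero (x : Site d) : ∀ᵐ f ∂walkLaw x, f 0 = x := by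
  have hs : MeasurableSet {f : ℕ → Site d | f 0 = x} :=
    (measurable_pi_apply (X := fun _ : ℕ => Site d) 0) (measurableSet_singleton x)
  refine (ae_map_iff (measurable_walkPath x).aemeasurable hs).2 ?_
  simp [walkPath]

/-- A nonnegative superharmonic function that is strictly superharmonic at `y` bounds the Green
function with pole at `y`. -/
lemma tsum_walkLaw_mul_le {V : Site d → ℝ≥0∞} {y : Site d} {δ : ℝ≥0∞}
    (hV : ∀ z, walkStep V z + (if z = y then δ else 0) ≤ V z) (x : Site d) :
    (∑' n : ℕ, walkLaw x {f | f n = y}) * δ ≤ V x := by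
  -- Each visit to `y` costs at least `δ` of expected potential, and the initial potential is `V x`;
  -- induction on time keeps this account.
  have key (n : ℕ) : ∫⁻ f, V (f n) ∂walkLaw x +
      ∑ k ∈ Finset.range n, walkLaw x {f | f k = y} * δ ≤ V x := by
    induction n with
    | zero =>
      rw [Finset.range_zero, Finset.sum_empty, add_zero,
        lintegral_congr_ae ((walkLaw_zero x).mono fun f hf => congrArg V hf)]
      simp
    | succ n ih =>
      refine le_trans ?_ ih
      rw [Finset.sum_range_succ, add_comm _ (_ * δ), ← add_assoc]
      gcongr
      rw [lintegral_walkLaw_succ]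
      have hs : MeasurableSet {f : ℕ → Site d | f n = y} :=
        (measurable_pi_apply (X := fun _ : ℕ => Site d) n) (measurableSet_singleton y)
      have h1 : walkLaw x {f | f n = y} * δ = ∫⁻ f, (if f n = y then δ else 0) ∂walkLaw x := by
        rw [mul_comm, ← lintegral_indicator_const hs]
        refine lintegral_congr fun f => ?_
        simp [Set.indicator_apply]
      rw [h1, ← lintegral_add_left (measurable_comp_eval (walkStep V) n)]
      exact lintegral_mono fun f => hV (f n)
  rw [← ENNReal.tsum_mul_right, ENNReal.tsum_eq_iSup_nat]
  exact iSup_le fun n => le_add_self.trans (key n)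

end Interlacement

/-- A second order bound for `t ↦ t ^ (-1 / 4)`. -/
lemma rpow_neg_quarter_le {s t : ℝ} (hs : 0 < s) (h : |t - s| ≤ s / 16) :
    t ^ (-(1 / 4) : ℝ) ≤
      s ^ (-(1 / 4) : ℝ) * (1 - (t - s) / s / 4 + 3 / 16 * ((t - s) / s) ^ 2) := by
  set r := (t - s) / s with hr
  have hr1 : |r| ≤ 1 / 16 := by
    rw [hr, abs_div, abs_of_pos hs, div_le_iff₀ hs]
    linarith
  obtain ⟨hr2, hr3⟩ := abs_le.1 hr1
  have ht : t = s * (1 + r) := by rw [hr]; field_simp; ring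
  have ht0 : 0 < t := by rw [ht]; exact mul_pos hs (by linarith)
  -- The Taylor coefficient of `r²` in `(1 + r)^(-1/4)` is `5/32`; the larger `3/16` absorbs the
  -- remainder for `|r| ≤ 1/16`. Fourth powers then turn the claim into a polynomial inequality in
  -- `r`.
  have hq : 0 ≤ 1 - r / 4 + 3 / 16 * r ^ 2 := by nlinarith
  have hpow {a : ℝ} (ha : 0 < a) : (a ^ (-(1 / 4) : ℝ)) ^ 4 = a⁻¹ := by
    rw [← Real.rpow_natCast, ← Real.rpow_mul ha.le, ← Real.rpow_neg_one]
    norm_num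
  rw [← pow_le_pow_iff_left₀ (Real.rpow_nonneg ht0.le _)
    (mul_nonneg (Real.rpow_nonneg hs.le _) hq) (n := 4) (by norm_num), mul_pow, hpow hs, hpow ht0,
    inv_mul_eq_div, le_div_iff₀ hs, inv_mul_eq_div, div_le_iff₀ ht0, ht, mul_comm, mul_assoc]
  refine le_mul_of_one_le_right hs.le ?_
  -- Squaring twice, with each cubic term bounded by `r³ ≤ r²/16`: `221/512 = 7/16 - 3/512`, and
  -- `1086/1000` lies just below `1/4 + 221/256 - 221/8192`. Multiplication by `1 + r` leaves `1 +
  -- 0.086 r² + 1.086 r³`, at least 1 because `r ≥ -1/16`.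
  have h1 : 1 - r / 2 + 221 / 512 * r ^ 2 ≤ (1 - r / 4 + 3 / 16 * r ^ 2) ^ 2 := by
    nlinarith [mul_nonneg (sq_nonneg r) (sub_nonneg.2 hr3), sq_nonneg (r ^ 2)]
  have h2 : 0 ≤ 1 - r / 2 + 221 / 512 * r ^ 2 := by nlinarith
  have h3 : 1 - r + 1086 / 1000 * r ^ 2 ≤ (1 - r / 2 + 221 / 512 * r ^ 2) ^ 2 := by
    nlinarith [mul_nonneg (sq_nonneg r) (sub_nonneg.2 hr3), sq_nonneg (r ^ 2)]
  have h4 : 1 - r + 1086 / 1000 * r ^ 2 ≤ (1 - r / 4 + 3 / 16 * r ^ 2) ^ 4 := by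
    refine h3.trans ?_
    rw [show (1 - r / 4 + 3 / 16 * r ^ 2) ^ 4 = ((1 - r / 4 + 3 / 16 * r ^ 2) ^ 2) ^ 2 by ring]
    exact pow_le_pow_left₀ h2 h1 2
  have h5 : 0 ≤ 1 + r := by linarith
  have h6 := mul_le_mul_of_nonneg_right h4 h5
  nlinarith [mul_nonneg (sq_nonneg r) (by linarith : 0 ≤ r + 1 / 16)]

namespace Interlacement

variable {d : ℕ}

/-- The squared Euclidean norm plus a constant. -/
def sqNormAdd (C : ℝ) (x : Site d) : ℝ := ∑ i, (x i : ℝ) ^ 2 + C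

lemma sqNormAdd_add_single (C : ℝ) (x : Site d) (i : Fin d) (a : ℤ) :
    sqNormAdd C (x + Pi.single i a) = sqNormAdd C x + 2 * a * x i + a ^ 2 := by
  have h : ∀ j, (((x + Pi.single i a : Site d) j : ℤ) : ℝ) ^ 2 =
      (x j : ℝ) ^ 2 + (if j = i then 2 * a * (x i : ℝ) + a ^ 2 else 0) := by
    intro j
    by_cases hj : j = i
    · subst hj
      simp
      ring
    · simp [hj]
  simp only [sqNormAdd, h, Finset.sum_add_distrib, Finset.sum_ite_eq', Finset.mem_univ, if_true]
  ring

/-- Superharmonicity of `s^(-1/4)` for `s = |x|² + C`. In the expansion around `s`, linear terms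
gain `d / (2s)` in total and quadratic terms lose about `3 / (2s)`, so `d = 3` is the borderline;
the constant `C` pays for the rest. -/
lemma sum_sqNormAdd_rpow_le (hd : 3 ≤ d) {C : ℝ} (hC : 528 + d ≤ C) (x : Site d) :
    ∑ i : Fin d, (sqNormAdd C (x + Pi.single i 1) ^ (-(1 / 4) : ℝ) +
      sqNormAdd C (x + -Pi.single i 1) ^ (-(1 / 4) : ℝ)) ≤
      2 * d * sqNormAdd C x ^ (-(1 / 4) : ℝ) := by
  set s := sqNormAdd C x with hs
  have hd' : (3 : ℝ) ≤ d := by exact_mod_cast hd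
  have hsum : ∑ i, (x i : ℝ) ^ 2 = s - C := by rw [hs, sqNormAdd]; ring
  have hx (i : Fin d) : (x i : ℝ) ^ 2 ≤ s - C := by
    rw [← hsum]
    exact Finset.single_le_sum (f := fun i => (x i : ℝ) ^ 2) (fun i _ => sq_nonneg _)
      (Finset.mem_univ i)
  have hsC : C ≤ s := by
    have : 0 ≤ ∑ i, (x i : ℝ) ^ 2 := Finset.sum_nonneg fun i _ => sq_nonneg _
    linarith
  have hs0 : 0 < s := by linarith
  have hφ : 0 ≤ s ^ (-(1 / 4) : ℝ) := Real.rpow_nonneg hs0.le _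
  have hi (i : Fin d) : sqNormAdd C (x + Pi.single i 1) ^ (-(1 / 4) : ℝ) +
      sqNormAdd C (x + -Pi.single i 1) ^ (-(1 / 4) : ℝ) ≤
      s ^ (-(1 / 4) : ℝ) * (2 - 1 / (2 * s) + 3 / 8 * (1 + 4 * (x i : ℝ) ^ 2) / s ^ 2) := by
    rw [← Pi.single_neg, sqNormAdd_add_single, sqNormAdd_add_single, ← hs]
    push_cast
    -- The requirement is `32 |x i| + 16 ≤ s`. Since `32 |x i| ≤ (x i)² / 2 + 512`, it holds once `C
    -- ≥ 512 + 16 = 528`.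
    have b1 := rpow_neg_quarter_le (t := s + 2 * 1 * x i + 1 ^ 2) hs0 (by
      rw [abs_le]
      constructor <;> nlinarith [hx i, sq_nonneg ((x i : ℝ) - 32), sq_nonneg ((x i : ℝ) + 32)])
    have b2 := rpow_neg_quarter_le (t := s + 2 * -1 * x i + (-1) ^ 2) hs0 (by
      rw [abs_le]
      constructor <;> nlinarith [hx i, sq_nonneg ((x i : ℝ) - 32), sq_nonneg ((x i : ℝ) + 32)])
    refine (add_le_add b1 b2).trans (le_of_eq ?_)
    field_simp
    ring
  refine (Finset.sum_le_sum fun i _ => hi i).trans ?_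
  rw [← Finset.mul_sum, mul_comm (2 * (d : ℝ))]
  refine mul_le_mul_of_nonneg_left ?_ hφ
  have h1 : ∑ i : Fin d, (2 - 1 / (2 * s) + 3 / 8 * (1 + 4 * (x i : ℝ) ^ 2) / s ^ 2) =
      d * (2 - 1 / (2 * s)) + 3 / 8 * (d + 4 * (s - C)) / s ^ 2 := by
    rw [Finset.sum_add_distrib, ← Finset.sum_div, ← Finset.mul_sum, Finset.sum_add_distrib,
      ← Finset.mul_sum, hsum]
    simp only [Finset.sum_const, Finset.card_univ, Fintype.card_fin, nsmul_eq_mul, mul_one]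
  rw [h1]
  have h2 : 3 / 8 * (d + 4 * (s - C)) / s ^ 2 ≤ d / (2 * s) := by
    rw [div_le_div_iff₀ (by positivity) (by positivity)]
    nlinarith [mul_nonneg hs0.le hs0.le]
  have h3 : (d : ℝ) * (2 - 1 / (2 * s)) = 2 * d - d / (2 * s) := by
    rw [mul_sub, mul_one_div, mul_comm]
  linarith

variable [NeZero d]

/-- Simple random walk on `ℤ^d` is transient for `d ≥ 3`. -/
theorem tsum_walkLaw_lt_top (hd : 3 ≤ d) (x y : Site d) :
    ∑' n : ℕ, walkLaw x {f | f n = y} < ∞ := by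
  set C : ℝ := 528 + d with hC
  have hC0 : 0 < C := by positivity
  have hs0 (z : Site d) : 0 < sqNormAdd C z := by
    have : 0 ≤ ∑ i, (z i : ℝ) ^ 2 := Finset.sum_nonneg fun i _ => sq_nonneg _
    unfold sqNormAdd; linarith
  set φ : Site d → ℝ := fun z => sqNormAdd C z ^ (-(1 / 4) : ℝ) with hφ
  have hφ0 (z) : 0 ≤ φ z := Real.rpow_nonneg (hs0 z).le _
  -- All neighbours of the origin have squared norm 1, so `δ` is exactly the drop of `φ` under one
  -- averaging step at the origin.
  set δ : ℝ := C ^ (-(1 / 4) : ℝ) - (C + 1) ^ (-(1 / 4) : ℝ) with hδ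
  have hδ0 : 0 < δ := by
    rw [hδ, sub_pos]
    exact Real.rpow_lt_rpow_of_neg hC0 (by linarith) (by norm_num)
  have hd0 : (0 : ℝ) < 2 * d := by
    have : (0 : ℝ) < d := by exact_mod_cast (by omega : 0 < d)
    linarith
  have hreal (z : Site d) : (2 * d : ℝ)⁻¹ *
      ∑ i : Fin d, (φ (z + Pi.single i 1) + φ (z + -Pi.single i 1)) + (if z = 0 then δ else 0) ≤
      φ z := by
    split_ifs with hz
    · have h0 : sqNormAdd C (0 : Site d) = C := by simp [sqNormAdd]
      subst hz
      have h1 (i : Fin d) : φ (0 + Pi.single i 1) + φ (0 + -Pi.single i 1) =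
          2 * (C + 1) ^ (-(1 / 4) : ℝ) := by
        simp only [hφ]
        rw [← Pi.single_neg, sqNormAdd_add_single, sqNormAdd_add_single, h0]
        simp
        ring
      rw [Finset.sum_congr rfl fun i _ => h1 i]
      simp only [Finset.sum_const, Finset.card_univ, Fintype.card_fin, nsmul_eq_mul, hφ, h0, hδ]
      rw [show (d : ℝ) * (2 * (C + 1) ^ (-(1 / 4) : ℝ)) = 2 * d * (C + 1) ^ (-(1 / 4) : ℝ) by ring,
        inv_mul_cancel_left₀ hd0.ne']
      linarith
    · rw [add_zero, inv_mul_le_iff₀ hd0]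
      exact sum_sqNormAdd_rpow_le hd le_rfl z
  have hV (z : Site d) : walkStep (fun z => ENNReal.ofReal (φ (z - y))) z +
      (if z = y then ENNReal.ofReal δ else 0) ≤ ENNReal.ofReal (φ (z - y)) := by
    refine le_trans (le_of_eq ?_) (ENNReal.ofReal_le_ofReal (hreal (z - y)))
    rw [ENNReal.ofReal_add (mul_nonneg (by positivity)
      (Finset.sum_nonneg fun i _ => add_nonneg (hφ0 _) (hφ0 _))) (by split_ifs <;> positivity),
      walkStep_eq, ENNReal.ofReal_mul (by positivity), ENNReal.ofReal_inv_of_pos hd0,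
      ENNReal.ofReal_mul (by norm_num), ENNReal.ofReal_natCast, ENNReal.ofReal_ofNat,
      ENNReal.ofReal_sum_of_nonneg fun i _ => add_nonneg (hφ0 _) (hφ0 _)]
    congr 1
    · congr 1
      refine Finset.sum_congr rfl fun i _ => ?_
      rw [ENNReal.ofReal_add (hφ0 _) (hφ0 _), add_sub_right_comm, add_sub_right_comm]
    · simp only [sub_eq_zero]
      split_ifs <;> simp
  have h := tsum_walkLaw_mul_le hV x
  have h' : (∑' n : ℕ, walkLaw x {f | f n = y}) * ENNReal.ofReal δ < ∞ :=
    h.trans_lt ENNReal.ofReal_lt_top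
  exact ENNReal.lt_top_of_mul_ne_top_left h'.ne (by simpa using hδ0)

end Interlacement

/-! ### Exponential variables and moments of the intensity measure -/

/-- `x ^ n` times the exponential density is `n!` times the Gamma density with shape `n + 1`. -/
lemma lintegral_ofReal_mul_pow_expMeasure (n : ℕ) :
    ∫⁻ x, ENNReal.ofReal (x ^ n) ∂expMeasure 1 = n.factorial := by
  have h1 (x : ℝ) : gammaPDF 1 1 x * ENNReal.ofReal (x ^ n) =
      n.factorial * gammaPDF (n + 1) 1 x := by
    rcases lt_or_ge x 0 with hx | hx
    · rw [gammaPDF_of_neg hx, gammaPDF_of_neg hx, zero_mul, mul_zero]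
    · rw [gammaPDF_of_nonneg hx, gammaPDF_of_nonneg hx, ← ENNReal.ofReal_natCast,
        ← ENNReal.ofReal_mul' (by positivity), ← ENNReal.ofReal_mul (by positivity)]
      congr 1
      rw [Real.Gamma_nat_eq_factorial, add_sub_cancel_right, Real.rpow_natCast]
      have : (n.factorial : ℝ) ≠ 0 := by positivity
      simp
      field_simp
  have hm (a : ℝ) : Measurable (gammaPDF a 1) := (measurable_gammaPDFReal a 1).ennreal_ofReal
  rw [expMeasure, gammaMeasure, lintegral_withDensity_eq_lintegral_mul _ (hm 1) (by fun_prop)]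
  simp only [Pi.mul_apply, h1]
  rw [lintegral_const_mul _ (hm _), lintegral_gammaPDF_eq_one (by positivity) one_pos, mul_one]

lemma ae_expMeasure_pos : ∀ᵐ x ∂expMeasure 1, 0 < x := by
  have := isProbabilityMeasure_expMeasure one_pos
  have h : expMeasure 1 (Set.Iic 0) = 0 := by
    rw [← ofReal_cdf, cdf_expMeasure_eq one_pos]
    simp
  filter_upwards [measure_eq_zero_iff_ae_notMem.1 h] with x hx
  simpa using hx

/-- A subsequence of an i.i.d. sequence of exponential variables is almost surely not summable. -/
lemma ae_tsum_infinitePi_expMeasure [IsProbabilityMeasure (expMeasure 1)] {ι : Type*} {e : ℕ → ι}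
    (he : Function.Injective e) : ∀ᵐ σ ∂(Measure.infinitePi fun _ : ι => expMeasure 1),
      ∑' n, ENNReal.ofReal (σ (e n)) = ∞ := by
  classical
  set Q := Measure.infinitePi fun _ : ι => expMeasure 1 with hQ
  set s : ℕ → Set (ι → ℝ) := fun n => (fun σ => σ (e n)) ⁻¹' Set.Ioi 1 with hs
  have hind : iIndepFun (fun (n : ℕ) (σ : ι → ℝ) => σ (e n)) Q :=
    (iIndepFun_infinitePi (P := fun _ : ι => expMeasure 1) (X := fun _ s => s)
      fun _ => measurable_id).precomp he
  have hsm (n) : MeasurableSet (s n) := measurable_pi_apply (e n) measurableSet_Ioi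
  have hsi : iIndepSet s Q := (iIndepSet_iff_meas_biInter hsm).2 fun t =>
    hind.measure_inter_preimage_eq_mul t fun _ _ => measurableSet_Ioi
  have hp (n) : Q (s n) = expMeasure 1 (Set.Ioi 1) :=
    (measurePreserving_eval_infinitePi (fun _ : ι => expMeasure 1) (e n)).measure_preimage
      measurableSet_Ioi.nullMeasurableSet
  have hp0 : expMeasure 1 (Set.Ioi 1) ≠ 0 := by
    rw [← Set.compl_Iic, prob_compl_eq_one_sub measurableSet_Iic, ← ofReal_cdf,
      cdf_expMeasure_eq one_pos]
    simp only [zero_le_one, if_true, mul_one, ne_eq, tsub_eq_zero_iff_le, not_le,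
      ENNReal.ofReal_lt_one, sub_lt_self_iff]
    exact Real.exp_pos _
  -- Second Borel–Cantelli lemma: the events `σ (e n) > 1` are independent with a common positive
  -- probability, so infinitely many occur, which a summable series excludes.
  have hone := measure_limsup_eq_one hsm hsi (by simp [hp, ENNReal.tsum_const_eq_top_of_ne_zero hp0])
  have hmem : ∀ᵐ σ ∂Q, σ ∈ limsup s atTop :=
    (prob_compl_eq_zero_iff (.measurableSet_limsup hsm)).2 hone
  filter_upwards [hmem] with σ hσ
  by_contra hne
  have hfin := ENNReal.finite_const_le_of_tsum_ne_top hne one_ne_zero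
  rw [mem_limsup_iff_frequently_mem, Nat.frequently_atTop_iff_infinite] at hσ
  refine hσ (hfin.subset fun n hn => ?_)
  have : (1 : ℝ) < σ (e n) := hn
  simpa using this.le

/-! ### Two-sided walks and mass transport. -/

namespace Interlacement

variable {d : ℕ}

lemma IsNeighbor.symm {x y : Site d} (h : IsNeighbor x y) : IsNeighbor y x := by
  obtain ⟨i, h | h⟩ := h
  · exact ⟨i, Or.inr (by rw [← h, neg_sub])⟩
  · exact ⟨i, Or.inl (by rw [← neg_sub, h, neg_neg])⟩

/-- The time spent at `x` at step `n`. -/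
noncomputable def stepTime (x : Site d) (n : ℤ) (w : RawPath d) : ℝ≥0∞ :=
  if (w n).1 = x then ENNReal.ofReal (w n).2 else 0

lemma measurable_stepTime (x : Site d) (n : ℤ) : Measurable (stepTime x n) :=
  Measurable.ite (measurableSet_pos {x} n) (by fun_prop) measurable_const

lemma stepTime_shift (x : Site d) (n : ℤ) (w : RawPath d) :
    stepTime x n (shift w) = stepTime x (n + 1) w := rfl

variable [NeZero d]

lemma ae_walkLaw_isNeighbor (x : Site d) : ∀ᵐ f ∂walkLaw x, ∀ n, IsNeighbor (f n) (f (n + 1)) := by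
  refine ae_all_iff.2 fun n => ?_
  have hm : MeasurableSet {f : ℕ → Site d | IsNeighbor (f n) (f (n + 1))} :=
    (by fun_prop : Measurable fun f : ℕ → Site d => (f n, f (n + 1)))
      (Set.to_countable {p : Site d × Site d | IsNeighbor p.1 p.2}).measurableSet
  refine (ae_map_iff (measurable_walkPath x).aemeasurable hm).2 ?_
  have hstep : ∀ᵐ s ∂stepLaw d, ∃ i : Fin d, s = Pi.single i 1 ∨ s = -Pi.single i 1 := by
    rw [ae_iff, stepLaw, Measure.smul_apply, Measure.finsetSum_apply, smul_eq_mul]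
    refine mul_eq_zero_of_right _ (Finset.sum_eq_zero fun i _ => ?_)
    rw [Measure.add_apply, Measure.dirac_apply' _ (Set.to_countable _).measurableSet,
      Measure.dirac_apply' _ (Set.to_countable _).measurableSet, add_eq_zero]
    exact ⟨Set.indicator_of_notMem (not_not.2 ⟨i, Or.inl rfl⟩) _,
      Set.indicator_of_notMem (not_not.2 ⟨i, Or.inr rfl⟩) _⟩
  filter_upwards [(measurePreserving_eval_infinitePi (fun _ : ℕ => stepLaw d)
    n).quasiMeasurePreserving.ae hstep] with ξ hξ
  simpa [IsNeighbor, walkPath, Finset.sum_range_succ] using hξ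

/-- First Borel–Cantelli lemma, with the finiteness of the Green function as the summability
condition. -/
lemma ae_walkLaw_finite (hd : 3 ≤ d) (x : Site d) :
    ∀ᵐ f ∂walkLaw x, ∀ y, {n | f n = y}.Finite :=
  ae_all_iff.2 fun y =>
    ae_finite_setOfPred_mem (s := fun n => {f : ℕ → Site d | f n = y})
      (tsum_walkLaw_lt_top hd x y).ne

/-- The law of the two-sided walk started at `x`, with holding times. -/
noncomputable def twoSidedAt (x : Site d) : Measure (RawPath d) :=
  (((walkLaw x).prod (walkLaw x)).prod (Measure.infinitePi fun _ : ℤ => expMeasure 1)).map glue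

lemma ae_prod_walkLaw {x : Site d} {p : (ℕ → Site d) → Prop} (h : ∀ᵐ f ∂walkLaw x, p f) :
    ∀ᵐ q ∂((walkLaw x).prod (walkLaw x)).prod (Measure.infinitePi fun _ : ℤ => expMeasure 1),
      p q.1.1 ∧ p q.1.2 :=
  (Measure.quasiMeasurePreserving_fst.ae (Measure.quasiMeasurePreserving_fst.ae h)).and
    (Measure.quasiMeasurePreserving_fst.ae (Measure.quasiMeasurePreserving_snd.ae h))

/-- This guarantees that no mass is lost when `Q_K`, defined on all sequences, is pulled back to the
space of admissible trajectories. -/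
lemma ae_twoSidedAt_mem_pathSet (hd : 3 ≤ d) (x : Site d) :
    ∀ᵐ w ∂twoSidedAt x, w ∈ pathSet d := by
  refine (ae_map_iff measurable_glue.aemeasurable (measurableSet_pathSet d)).2 ?_
  set Q := Measure.infinitePi fun _ : ℤ => expMeasure 1 with hQ
  have hσ : ∀ᵐ σ ∂Q, (∀ n, 0 < σ n) ∧ ∑' n : ℕ, ENNReal.ofReal (σ n) = ∞ ∧
      ∑' n : ℕ, ENNReal.ofReal (σ (-n)) = ∞ := by
    refine (ae_all_iff.2 fun n => ?_).and ((ae_tsum_infinitePi_expMeasure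
      (e := fun n : ℕ => (n : ℤ)) Nat.cast_injective).and (ae_tsum_infinitePi_expMeasure
      (e := fun n : ℕ => -(n : ℤ)) (neg_injective.comp Nat.cast_injective)))
    exact (measurePreserving_eval_infinitePi (fun _ : ℤ => expMeasure 1)
      n).quasiMeasurePreserving.ae ae_expMeasure_pos
  filter_upwards [ae_prod_walkLaw (walkLaw_zero x), ae_prod_walkLaw (ae_walkLaw_isNeighbor x),
    ae_prod_walkLaw (ae_walkLaw_finite hd x), Measure.quasiMeasurePreserving_snd.ae hσ]
    with q h0 hnb hfin hq
  refine ⟨fun n => ?_, fun y => ?_, hq.1, hq.2.1, hq.2.2⟩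
  · simp only [glue]
    -- The step from time `-1` to time `0` joins the backward half to the forward one; it is a
    -- neighbour step because both halves start at `x`.
    rcases lt_trichotomy n (-1) with hn | rfl | hn
    · rw [if_neg (by omega), if_neg (by omega), show (-n).toNat = (-(n + 1)).toNat + 1 by omega]
      exact (hnb.2 _).symm
    · have := hnb.2 0
      simp only [h0.2] at this
      simpa [h0.1] using this.symm
    · rw [if_pos (by omega), if_pos (by omega), show (n + 1).toNat = n.toNat + 1 by omega]
      exact hnb.1 _
  · refine (((hfin.1 y).image fun n : ℕ => (n : ℤ)).union
      ((hfin.2 y).image fun n : ℕ => -(n : ℤ))).subset fun n hn => ?_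
    simp only [glue, Set.mem_ofPred_eq] at hn
    split_ifs at hn with h
    · exact Or.inl ⟨n.toNat, hn, by simp [h]⟩
    · exact Or.inr ⟨(-n).toNat, hn, by simp only; omega⟩

lemma twoSided_eq_sum : twoSided d = Measure.sum twoSidedAt := rfl

lemma ae_twoSided_mem_pathSet (hd : 3 ≤ d) : ∀ᵐ w ∂twoSided d, w ∈ pathSet d := by
  rw [twoSided_eq_sum, Measure.ae_sum_iff]
  exact ae_twoSidedAt_mem_pathSet hd

/-- Mass transport: integrating a shift invariant weight times the total time spent at `x`, over the
trajectories that visit `x` first at time `0`, amounts to integrating over those at `x` at time `0`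
with the holding time as density. -/
lemma setLIntegral_firstAt_tsum_stepTime (hd : 3 ≤ d) (x : Site d) {H : RawPath d → ℝ≥0∞}
    (hH : Measurable H) (hs : ∀ w, H (shift w) = H w) :
    ∫⁻ w in firstAt {x} 0, (∑' n, stepTime x n w) * H w ∂twoSided d =
      ∫⁻ w, stepTime x 0 w * H w ∂twoSided d := by
  -- `j` is the time of the first visit to `x` and `n` the time whose holding time is counted. By
  -- shift invariance `m j n` depends only on `n - j`, so summing over `n` at `j = 0` equals summing
  -- over `j` at `n = 0`.
  set m : ℤ → ℤ → ℝ≥0∞ := fun j n =>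
    ∫⁻ w in firstAt {x} j, stepTime x n w * H w ∂twoSided d with hm
  have hmeas (n : ℤ) : Measurable fun w => stepTime x n w * H w := (measurable_stepTime x n).mul hH
  have hstep (j n : ℤ) : m (j + 1) (n + 1) = m j n := by
    simp only [hm]
    rw [← (measurePreserving_shift d).setLIntegral_comp_preimage (measurableSet_firstAt _ _)
      (hmeas n), firstAt_shift]
    simp only [stepTime_shift, hs]
  have hinv (b j : ℤ) : m j (b + j) = m 0 b := by
    induction j using Int.induction_on with
    | zero => simp
    | succ i ih => rw [← add_assoc, hstep, ih]
    | pred i ih => rw [← ih, ← hstep]; congr 1 <;> ring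
  have h1 : ∫⁻ w in firstAt {x} 0, (∑' n, stepTime x n w) * H w ∂twoSided d = ∑' n, m 0 n := by
    simp_rw [← ENNReal.tsum_mul_right]
    exact lintegral_tsum fun n => (hmeas n).aemeasurable
  have h2 : ∫⁻ w, stepTime x 0 w * H w ∂twoSided d = ∑' k, m k 0 := by
    simp only [hm]
    rw [← lintegral_iUnion (fun k => measurableSet_firstAt _ k) (firstAt_disjoint {x}),
      ← lintegral_indicator (.iUnion fun k => measurableSet_firstAt _ k)]
    refine lintegral_congr_ae ?_
    -- A path at `x` at time 0 has a first visit to `x` since it visits `x` finitely often; off that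
    -- event the integrand is zero.
    filter_upwards [ae_twoSided_mem_pathSet hd] with w hw
    by_cases h0 : (w 0).1 = x
    · rw [Set.indicator_of_mem]
      exact Set.mem_iUnion.2 (exists_firstAt {x} hw ⟨0, by simp [h0]⟩)
    · have hz : stepTime x 0 w * H w = 0 := by simp [stepTime, h0]
      exact hz.trans ((Set.indicator_apply_eq_zero (f := fun w => stepTime x 0 w * H w)).2 fun _ => hz).symm
  rw [h1, h2, ← (Equiv.neg ℤ).tsum_eq fun k => m k 0]
  refine tsum_congr fun k => ?_
  rw [← hinv k (-k)]
  simp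

lemma ae_twoSidedAt_zero (x : Site d) : ∀ᵐ w ∂twoSidedAt x, (w 0).1 = x := by
  refine (ae_map_iff measurable_glue.aemeasurable (measurableSet_pos {x} 0)).2 ?_
  filter_upwards [ae_prod_walkLaw (walkLaw_zero x)] with q hq
  simpa [glue] using hq.1

lemma lintegral_stepTime_zero_mul (x : Site d) (H : RawPath d → ℝ≥0∞) :
    ∫⁻ w, stepTime x 0 w * H w ∂twoSided d =
      ∫⁻ w, ENNReal.ofReal (w 0).2 * H w ∂twoSidedAt x := by
  rw [twoSided_eq_sum, lintegral_sum_measure, tsum_eq_single x]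
  · refine lintegral_congr_ae ?_
    filter_upwards [ae_twoSidedAt_zero x] with w hw
    simp [stepTime, hw]
  · intro z hz
    rw [← lintegral_zero (μ := twoSidedAt z)]
    refine lintegral_congr_ae ?_
    filter_upwards [ae_twoSidedAt_zero z] with w hw
    simp [stepTime, hw, hz]

lemma lintegral_ofReal_expMeasure (n : ℤ) :
    ∫⁻ σ, ENNReal.ofReal (σ n) ∂(Measure.infinitePi fun _ : ℤ => expMeasure 1) = 1 := by
  have h := (measurePreserving_eval_infinitePi (fun _ : ℤ => expMeasure 1) n).lintegral_comp
    (f := fun x => ENNReal.ofReal x) (by fun_prop)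
  have h1 := lintegral_ofReal_mul_pow_expMeasure 1
  simp only [pow_one, Nat.factorial_one, Nat.cast_one] at h1
  exact h.trans h1

lemma lintegral_ofReal_mul_ofReal_expMeasure (n : ℤ) :
    ∫⁻ σ, ENNReal.ofReal (σ 0) * ENNReal.ofReal (σ n)
      ∂(Measure.infinitePi fun _ : ℤ => expMeasure 1) = if n = 0 then 2 else 1 := by
  split_ifs with hn
  · subst hn
    have h := (measurePreserving_eval_infinitePi (fun _ : ℤ => expMeasure 1) 0).lintegral_comp
      (f := fun x => ENNReal.ofReal x * ENNReal.ofReal x) (by fun_prop)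
    refine h.trans ?_
    have h2 := lintegral_ofReal_mul_pow_expMeasure 2
    simp only [Nat.factorial_two, Nat.cast_ofNat] at h2
    rw [← h2]
    refine lintegral_congr_ae ?_
    filter_upwards [ae_expMeasure_pos] with x hx
    rw [← ENNReal.ofReal_mul hx.le, sq]
  · have hind : iIndepFun (fun (n : ℤ) (σ : ℤ → ℝ) => ENNReal.ofReal (σ n))
        (Measure.infinitePi fun _ : ℤ => expMeasure 1) :=
      iIndepFun_infinitePi (P := fun _ : ℤ => expMeasure 1) (X := fun _ s => ENNReal.ofReal s)
        fun _ => ENNReal.measurable_ofReal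
    have h := lintegral_mul_eq_lintegral_mul_lintegral_of_indepFun (by fun_prop) (by fun_prop)
      (hind.indepFun (Ne.symm hn))
    simp only [lintegral_ofReal_expMeasure, mul_one] at h
    exact h

lemma lintegral_twoSidedAt_mul_stepTime (x y : Site d) (n : ℤ) :
    ∫⁻ w, ENNReal.ofReal (w 0).2 * stepTime y n w ∂twoSidedAt x =
      walkLaw x {f | f n.natAbs = y} * if n = 0 then 2 else 1 := by
  have hm : Measurable fun w : RawPath d => ENNReal.ofReal (w 0).2 * stepTime y n w :=
    Measurable.mul (by fun_prop) (measurable_stepTime y n)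
  have hset : MeasurableSet {f : ℕ → Site d | f n.natAbs = y} :=
    measurable_pi_apply (X := fun _ : ℕ => Site d) n.natAbs (measurableSet_singleton y)
  set φ : (ℕ → Site d) × (ℕ → Site d) → ℝ≥0∞ := fun q =>
    ({f : ℕ → Site d | f n.natAbs = y}.indicator 1 (if 0 ≤ n then q.1 else q.2)) with hφ
  have hφm : Measurable φ := by
    refine (measurable_const.indicator hset).comp ?_
    split_ifs
    exacts [measurable_fst, measurable_snd]
  have hφi : ∫⁻ q, φ q ∂(walkLaw x).prod (walkLaw x) = walkLaw x {f | f n.natAbs = y} := by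
    have hi := lintegral_indicator_one (μ := walkLaw x) hset
    simp only [hφ]
    split_ifs
    · exact (measurePreserving_fst.lintegral_comp (measurable_const.indicator hset)).trans hi
    · exact (measurePreserving_snd.lintegral_comp (measurable_const.indicator hset)).trans hi
  have hprod : ∀ q : ((ℕ → Site d) × (ℕ → Site d)) × (ℤ → ℝ),
      ENNReal.ofReal (glue q 0).2 * stepTime y n (glue q) =
        φ q.1 * (ENNReal.ofReal (q.2 0) * ENNReal.ofReal (q.2 n)) := by
    intro q
    have h0 : (n.toNat = n.natAbs ∧ 0 ≤ n) ∨ ((-n).toNat = n.natAbs ∧ ¬ 0 ≤ n) := by omega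
    rcases h0 with ⟨h, h'⟩ | ⟨h, h'⟩ <;>
    simp [stepTime, glue, hφ, h, h', Set.indicator_apply]
  rw [twoSidedAt, lintegral_map hm measurable_glue]
  simp_rw [hprod]
  have hσ : Measurable fun σ : ℤ → ℝ => ENNReal.ofReal (σ 0) * ENNReal.ofReal (σ n) := by fun_prop
  refine (lintegral_prod_mul hφm.aemeasurable hσ.aemeasurable).trans ?_
  rw [hφi, lintegral_ofReal_mul_ofReal_expMeasure]

/-- The forward and the backward half each contribute the Green function. Time 0 belongs to both
halves but occurs once in the sum over `ℤ`; this is compensated by `E[σ²] = 2`, whereas `E[σ_0 σ_n]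
= 1` for `n ≠ 0`. -/
lemma lintegral_twoSidedAt_mul_tsum_stepTime (x y : Site d) :
    ∫⁻ w, ENNReal.ofReal (w 0).2 * ∑' n, stepTime y n w ∂twoSidedAt x =
      2 * ∑' n : ℕ, walkLaw x {f | f n = y} := by
  have hm (n : ℤ) : Measurable fun w : RawPath d => ENNReal.ofReal (w 0).2 * stepTime y n w :=
    Measurable.mul (by fun_prop) (measurable_stepTime y n)
  have hmul (w : RawPath d) : ENNReal.ofReal (w 0).2 * ∑' n, stepTime y n w =
      ∑' n, ENNReal.ofReal (w 0).2 * stepTime y n w := ENNReal.tsum_mul_left.symm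
  simp_rw [hmul]
  rw [lintegral_tsum fun n => (hm n).aemeasurable]
  simp_rw [lintegral_twoSidedAt_mul_stepTime]
  rw [tsum_of_nat_of_neg_add_one ENNReal.summable ENNReal.summable]
  have h1 (n : ℕ) : walkLaw x {f | f (n : ℤ).natAbs = y} * (if (n : ℤ) = 0 then 2 else 1) =
      (if n = 0 then walkLaw x {f | f 0 = y} else 0) + walkLaw x {f | f n = y} := by
    rcases n with _ | n
    · simp [mul_two]
    · simp [show ((n : ℤ) + 1) ≠ 0 by omega,
        show ((n : ℤ) + 1).natAbs = n + 1 by omega]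
  have h2 (n : ℕ) : walkLaw x {f | f (-((n : ℤ) + 1)).natAbs = y} *
      (if -((n : ℤ) + 1) = 0 then 2 else 1) = walkLaw x {f | f (n + 1) = y} := by
    rw [if_neg (by omega), mul_one, show (-((n : ℤ) + 1)).natAbs = n + 1 by omega]
  simp_rw [h1, h2]
  rw [ENNReal.tsum_add, tsum_ite_eq, two_mul, add_right_comm, add_comm]
  congr 1
  exact (tsum_eq_zero_add' (f := fun n => walkLaw x {f | f n = y}) ENNReal.summable).symm

/-- The weight `pathModTime x` vanishes off the trajectories entering `{x}`, so only `Q_{{x}}`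
matters, and mass transport removes the conditioning of its backward half. The choices `H = 1` and
`H = pathModTime y` give the first two moments. -/
lemma lintegral_intensity (hd : 3 ≤ d) (x : Site d) {H : PathMod d → ℝ≥0∞}
    {H' : RawPath d → ℝ≥0∞} (hH' : Measurable H') (hs : ∀ w, H' (shift w) = H' w)
    (hH : Measurable H) (h : ∀ w : Path d, H (proj d w) = H' w.1) :
    ∫⁻ w, pathModTime x w * H w ∂intensity d =
      ∫⁻ w, ENNReal.ofReal (w 0).2 * H' w ∂twoSidedAt x := by
  have hm : Measurable fun w => pathModTime x w * H w := (measurable_pathModTime x).mul hH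
  have h0 : ∫⁻ w, pathModTime x w * H w ∂intensity d =
      ∫⁻ w in enters {x}, pathModTime x w * H w ∂intensity d := by
    rw [← lintegral_indicator (measurableSet_enters _)]
    refine lintegral_congr fun w => ?_
    obtain ⟨v, rfl⟩ := Quotient.exists_rep w
    by_cases hv : proj d v ∈ enters {x}
    · exact (Set.indicator_of_mem hv fun w => pathModTime x w * H w).symm
    · refine Eq.trans ?_ (Set.indicator_of_notMem hv _).symm
      refine mul_eq_zero_of_left (ENNReal.tsum_eq_zero.2 fun n => if_neg fun hn => hv ?_) _
      exact (mem_enters _ v).2 ⟨n, by simp [hn]⟩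
  rw [h0, isIntensity_intensity d {x}, lintegral_map hm (measurable_proj d), entranceMeasure]
  have h1 : ∀ w : Path d, pathModTime x (proj d w) * H (proj d w) =
      (fun w : RawPath d => (∑' n, stepTime x n w) * H' w) w.1 := by
    intro w
    rw [h]
    rfl
  simp_rw [h1]
  refine (lintegral_subtype_comap (measurableSet_pathSet d)
    (fun w : RawPath d => (∑' n, stepTime x n w) * H' w)).trans ?_
  rw [rawQ_eq_restrict,
    Measure.restrict_eq_self_of_ae_mem (ae_restrict_of_ae (ae_twoSided_mem_pathSet hd)),
    setLIntegral_firstAt_tsum_stepTime hd x hH' hs, lintegral_stepTime_zero_mul]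

lemma lintegral_pathModTime (hd : 3 ≤ d) (x : Site d) :
    ∫⁻ w, pathModTime x w ∂intensity d = 1 := by
  have h := lintegral_intensity hd x (H := fun _ => 1) (H' := fun _ => 1) measurable_const
    (fun _ => rfl) measurable_const fun _ => rfl
  simp only [mul_one] at h
  have hm : Measurable fun w : RawPath d => ENNReal.ofReal (w 0).2 := by fun_prop
  rw [h, twoSidedAt, lintegral_map hm measurable_glue]
  exact (measurePreserving_snd.lintegral_comp
    (f := fun σ : ℤ → ℝ => ENNReal.ofReal (σ 0)) (by fun_prop)).trans
    (lintegral_ofReal_expMeasure 0)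

lemma lintegral_pathModTime_mul (hd : 3 ≤ d) (x y : Site d) :
    ∫⁻ w, pathModTime x w * pathModTime y w ∂intensity d =
      2 * ∑' n : ℕ, walkLaw x {f | f n = y} := by
  rw [← lintegral_twoSidedAt_mul_tsum_stepTime]
  refine lintegral_intensity hd x (Measurable.tsum fun n => measurable_stepTime y n) (fun w => ?_)
    (measurable_pathModTime y) fun _ => rfl
  simp only [stepTime_shift]
  exact (Equiv.addRight (1 : ℤ)).tsum_eq fun n => stepTime y n w

end Interlacement

/-! ### Expansions of characteristic functions -/

lemma norm_exp_mul_I_sub_one_le (x : ℝ) : ‖Complex.exp (x * Complex.I) - 1‖ ≤ |x| := by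
  have := Real.norm_exp_I_mul_ofReal_sub_one_le (x := x)
  rwa [mul_comm] at this

/-- Valid for every real `x`, unlike the third order bound below, and thus usable for domination:
for `|x| ≥ 1` the crude bound `2 |x|` is at most `2 x²`. -/
lemma norm_exp_mul_I_sub_one_sub_le (x : ℝ) :
    ‖Complex.exp (x * Complex.I) - 1 - x * Complex.I‖ ≤ 2 * x ^ 2 := by
  have hx : ‖(x : ℂ) * Complex.I‖ = |x| := by simp
  rcases le_total |x| 1 with h | h
  · refine (Complex.norm_exp_sub_one_sub_id_le (by rwa [hx])).trans ?_
    rw [hx, sq_abs]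
    nlinarith [sq_nonneg x]
  · refine (norm_sub_le _ _).trans ?_
    rw [hx, ← sq_abs]
    nlinarith [norm_exp_mul_I_sub_one_le x]

lemma norm_exp_mul_I_sub_taylor_le {x : ℝ} (hx : |x| ≤ 1) :
    ‖Complex.exp (x * Complex.I) - 1 - x * Complex.I + x ^ 2 / 2‖ ≤ |x| ^ 3 := by
  have hn : ‖(x : ℂ) * Complex.I‖ = |x| := by simp
  have h := Complex.exp_bound (x := x * Complex.I) (by rwa [hn]) (n := 3) (by norm_num)
  rw [hn] at h
  have he : Complex.exp (x * Complex.I) -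
      ∑ m ∈ Finset.range 3, ((x : ℂ) * Complex.I) ^ m / m.factorial =
      Complex.exp (x * Complex.I) - 1 - x * Complex.I + x ^ 2 / 2 := by
    simp [Finset.sum_range_succ, mul_pow, Nat.factorial]
    ring
  rw [he] at h
  refine h.trans (mul_le_of_le_one_right (by positivity) ?_)
  norm_num [Nat.factorial]

lemma tendsto_mul_exp_div_sub_one (y : ℝ) :
    Tendsto (fun u : ℝ => (u : ℂ) * (Complex.exp ((y / u : ℝ) * Complex.I) - 1)) atTop
      (nhds (y * Complex.I)) := by
  rw [tendsto_iff_norm_sub_tendsto_zero]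
  have hlim : Tendsto (fun u : ℝ => 2 * y ^ 2 / u) atTop (nhds 0) :=
    tendsto_const_nhds.div_atTop tendsto_id
  refine squeeze_zero' (Eventually.of_forall fun u => norm_nonneg _) ?_ hlim
  filter_upwards [eventually_gt_atTop 0] with u hu
  have hu' : (u : ℂ) ≠ 0 := by exact_mod_cast hu.ne'
  have h1 : (u : ℂ) * (Complex.exp ((y / u : ℝ) * Complex.I) - 1) - y * Complex.I =
      u * (Complex.exp ((y / u : ℝ) * Complex.I) - 1 - (y / u : ℝ) * Complex.I) := by
    push_cast
    field_simp
  rw [h1, norm_mul, Complex.norm_real, Real.norm_eq_abs, abs_of_pos hu]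
  refine (mul_le_mul_of_nonneg_left (norm_exp_mul_I_sub_one_sub_le (y / u)) hu.le).trans
    (le_of_eq ?_)
  field_simp

/-- With `s = √(2u)` one has `u = s² / 2`, so the quadratic term `-(y/s)² / 2` contributes `-y² / 4`
and the remainder is at most `|y|³ / (2s)`. -/
lemma tendsto_mul_exp_div_sqrt_sub (y : ℝ) :
    Tendsto (fun u : ℝ => (u : ℂ) * (Complex.exp ((y / √(2 * u) : ℝ) * Complex.I) - 1 -
      (y / √(2 * u) : ℝ) * Complex.I)) atTop (nhds (-(y ^ 2 / 4 : ℝ))) := by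
  have hsq : Tendsto (fun u : ℝ => √(2 * u)) atTop atTop :=
    Real.tendsto_sqrt_atTop.comp (tendsto_id.const_mul_atTop two_pos)
  rw [tendsto_iff_norm_sub_tendsto_zero]
  have hlim : Tendsto (fun u : ℝ => |y| ^ 3 / 2 / √(2 * u)) atTop (nhds 0) :=
    tendsto_const_nhds.div_atTop hsq
  refine squeeze_zero' (Eventually.of_forall fun u => norm_nonneg _) ?_ hlim
  filter_upwards [eventually_gt_atTop 0, hsq.eventually_ge_atTop |y|, hsq.eventually_gt_atTop 0]
    with u hu huy hs0
  set s := √(2 * u) with hs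
  have hu2 : u = s ^ 2 / 2 := by
    rw [hs, Real.sq_sqrt (by positivity)]
    ring
  have hs' : (s : ℂ) ≠ 0 := by exact_mod_cast hs0.ne'
  have h1 : (u : ℂ) * (Complex.exp ((y / s : ℝ) * Complex.I) - 1 - (y / s : ℝ) * Complex.I) -
      -(y ^ 2 / 4 : ℝ) = u * (Complex.exp ((y / s : ℝ) * Complex.I) - 1 -
        (y / s : ℝ) * Complex.I + (y / s : ℝ) ^ 2 / 2) := by
    rw [mul_add, sub_neg_eq_add]
    congr 1
    rw [hu2]
    push_cast
    field_simp
    norm_num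
  have hx : |y / s| ≤ 1 := by
    rw [abs_div, abs_of_pos hs0]
    exact (div_le_one hs0).2 huy
  rw [h1, norm_mul, Complex.norm_real, Real.norm_eq_abs, abs_of_pos hu]
  refine (mul_le_mul_of_nonneg_left (norm_exp_mul_I_sub_taylor_le hx) hu.le).trans (le_of_eq ?_)
  rw [abs_div, abs_of_pos hs0, hu2]
  field_simp

section Limits

variable {α : Type*} [MeasurableSpace α] {ν : Measure α} {F : α → ℝ}

/-- Dominated convergence with majorant `|F|`, the factor `u` cancelling the scale `1/u`; `ν` need
not be finite. -/
lemma tendsto_mul_integral_exp_div_sub_one (hF : Integrable F ν) :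
    Tendsto (fun u : ℝ => (u : ℂ) * ∫ w, (Complex.exp ((F w / u : ℝ) * Complex.I) - 1) ∂ν) atTop
      (nhds ((∫ w, F w ∂ν : ℝ) * Complex.I)) := by
  simp_rw [← integral_const_mul]
  rw [← integral_complex_ofReal, ← integral_mul_const]
  have hm := hF.aemeasurable
  refine tendsto_integral_filter_of_dominated_convergence (fun w => |F w|) ?_ ?_ hF.abs
    (ae_of_all _ fun w => tendsto_mul_exp_div_sub_one (F w))
  · exact Eventually.of_forall fun u => (by fun_prop : AEMeasurable _ ν).aestronglyMeasurable
  · filter_upwards [eventually_gt_atTop 0] with u hu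
    refine ae_of_all _ fun w => ?_
    rw [norm_mul, Complex.norm_real, Real.norm_eq_abs, abs_of_pos hu]
    refine (mul_le_mul_of_nonneg_left (norm_exp_mul_I_sub_one_le _) hu.le).trans (le_of_eq ?_)
    rw [abs_div, abs_of_pos hu]
    field_simp

/-- Since `F` has integral zero, the linear term, of order `√u` pointwise, can be subtracted for
free. What remains is dominated by `F²`. -/
lemma tendsto_mul_integral_exp_div_sqrt_sub_one (hF : Integrable F ν)
    (hF2 : Integrable (fun w => F w ^ 2) ν) (h0 : ∫ w, F w ∂ν = 0) :
    Tendsto (fun u : ℝ => (u : ℂ) * ∫ w, (Complex.exp ((F w / √(2 * u) : ℝ) * Complex.I) - 1) ∂ν)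
      atTop (nhds (-((∫ w, F w ^ 2 ∂ν) / 4 : ℝ))) := by
  have hm := hF.aemeasurable
  have hc (u : ℝ) : (u : ℂ) * ∫ w, (Complex.exp ((F w / √(2 * u) : ℝ) * Complex.I) - 1) ∂ν =
      ∫ w, (u : ℂ) * (Complex.exp ((F w / √(2 * u) : ℝ) * Complex.I) - 1 -
        (F w / √(2 * u) : ℝ) * Complex.I) ∂ν := by
    have hi1 : Integrable (fun w => Complex.exp ((F w / √(2 * u) : ℝ) * Complex.I) - 1) ν := by
      refine (hF.div_const (√(2 * u))).mono (by fun_prop : AEMeasurable _ ν).aestronglyMeasurable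
        (ae_of_all _ fun w => ?_)
      exact norm_exp_mul_I_sub_one_le _
    have hi2 : Integrable (fun w => ((F w / √(2 * u) : ℝ) : ℂ) * Complex.I) ν :=
      (hF.div_const _).ofReal.mul_const _
    rw [integral_const_mul, integral_sub hi1 hi2, integral_mul_const, integral_complex_ofReal,
      integral_div, h0]
    simp
  simp_rw [hc]
  rw [show (-((∫ w, F w ^ 2 ∂ν) / 4 : ℝ) : ℂ) = ∫ w, (-(F w ^ 2 / 4 : ℝ) : ℂ) ∂ν by
    rw [integral_neg, integral_complex_ofReal, integral_div]]
  refine tendsto_integral_filter_of_dominated_convergence (fun w => F w ^ 2) ?_ ?_ hF2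
    (ae_of_all _ fun w => tendsto_mul_exp_div_sqrt_sub (F w))
  · exact Eventually.of_forall fun u => (by fun_prop : AEMeasurable _ ν).aestronglyMeasurable
  · filter_upwards [eventually_gt_atTop 0] with u hu
    refine ae_of_all _ fun w => ?_
    rw [norm_mul, Complex.norm_real, Real.norm_eq_abs, abs_of_pos hu]
    refine (mul_le_mul_of_nonneg_left (norm_exp_mul_I_sub_one_sub_le _) hu.le).trans (le_of_eq ?_)
    rw [div_pow, Real.sq_sqrt (by positivity)]
    field_simp

end Limits

/-! ### Levels, and moments of linear combinations of times spent at sites. -/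

namespace Interlacement

lemma levelMeasure_le (u : ℝ) : levelMeasure {v | (v : ℝ) ≤ u} = ENNReal.ofReal u := by
  have he : MeasurableEmbedding ((↑) : ℝ≥0 → ℝ) :=
    NNReal.isClosedEmbedding_coe.measurableEmbedding
  rw [levelMeasure, he.comap_apply]
  have : ((↑) : ℝ≥0 → ℝ) '' {v | (v : ℝ) ≤ u} = Set.Icc 0 u := by
    ext x
    constructor
    · rintro ⟨v, hv, rfl⟩
      exact ⟨v.2, hv⟩
    · exact fun hx => ⟨⟨x, hx.1⟩, hx.2, rfl⟩
  rw [this, Real.volume_Icc, sub_zero]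

instance : SigmaFinite levelMeasure :=
  ⟨⟨{ set := fun n : ℕ => {v | (v : ℝ) ≤ n}
      set_mem := fun _ => trivial
      finite := fun n => by simp [levelMeasure_le]
      spanning := by
        ext v
        simpa using exists_nat_ge (v : ℝ) }⟩⟩

lemma measurableSet_level (d : ℕ) (u : ℝ) :
    MeasurableSet {p : PathMod d × ℝ≥0 | (p.2 : ℝ) ≤ u} :=
  measurableSet_le (by fun_prop) measurable_const

/-- This reduces integrals over labelled trajectories up to level `u` to `u` times integrals against
`ν`. -/
lemma map_fst_restrict_level {d : ℕ} (ν : Measure (PathMod d)) (u : ℝ) :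
    ((ν.prod levelMeasure).restrict {p | (p.2 : ℝ) ≤ u}).map Prod.fst = ENNReal.ofReal u • ν := by
  ext s hs
  rw [Measure.map_apply measurable_fst hs, Measure.restrict_apply (measurable_fst hs)]
  have : Prod.fst ⁻¹' s ∩ {p : PathMod d × ℝ≥0 | (p.2 : ℝ) ≤ u} =
      s ×ˢ {v : ℝ≥0 | (v : ℝ) ≤ u} := rfl
  rw [this, Measure.prod_prod, levelMeasure_le u, mul_comm]
  rfl

/-- The time spent at `x` by a trajectory modulo time shift, as a real number. -/
noncomputable def realTime {d : ℕ} (x : Site d) (w : PathMod d) : ℝ := (pathModTime x w).toReal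

lemma measurable_realTime {d : ℕ} (x : Site d) : Measurable (realTime x) :=
  (measurable_pathModTime x).ennreal_toReal

/-- A linear combination of times spent at finitely many sites. -/
noncomputable def combTime {d : ℕ} {ι : Type*} [Fintype ι] (a : ι → ℝ) (z : ι → Site d)
    (w : PathMod d) : ℝ := ∑ i, a i * realTime (z i) w

lemma measurable_combTime {d : ℕ} {ι : Type*} [Fintype ι] (a : ι → ℝ) (z : ι → Site d) :
    Measurable (combTime a z) :=
  Finset.measurable_sum _ fun i _ => (measurable_realTime (z i)).const_mul (a i)

section Moments

variable {d : ℕ} [NeZero d]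

lemma integrable_realTime (hd : 3 ≤ d) (x : Site d) : Integrable (realTime x) (intensity d) :=
  integrable_toReal_of_lintegral_ne_top (measurable_pathModTime x).aemeasurable
    (by simp [lintegral_pathModTime hd])

lemma ae_pathModTime_lt_top (hd : 3 ≤ d) (x : Site d) : ∀ᵐ w ∂intensity d, pathModTime x w < ∞ :=
  ae_lt_top (measurable_pathModTime x) (by simp [lintegral_pathModTime hd])

lemma integral_realTime (hd : 3 ≤ d) (x : Site d) : ∫ w, realTime x w ∂intensity d = 1 := by
  have := integral_toReal (measurable_pathModTime x).aemeasurable (ae_pathModTime_lt_top hd x)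
  exact this.trans (by simp [lintegral_pathModTime hd])

lemma integrable_realTime_mul (hd : 3 ≤ d) (x y : Site d) :
    Integrable (fun w => realTime x w * realTime y w) (intensity d) := by
  have := integrable_toReal_of_lintegral_ne_top (μ := intensity d)
    ((measurable_pathModTime x).mul (measurable_pathModTime y)).aemeasurable
    (by simpa [lintegral_pathModTime_mul hd] using
      ENNReal.mul_ne_top (by simp) (tsum_walkLaw_lt_top hd x y).ne)
  simpa only [realTime, Pi.mul_apply, ENNReal.toReal_mul] using this

lemma integral_realTime_mul (hd : 3 ≤ d) (x y : Site d) :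
    ∫ w, realTime x w * realTime y w ∂intensity d = 2 * green x y := by
  have h := integral_toReal (μ := intensity d)
    ((measurable_pathModTime x).mul (measurable_pathModTime y)).aemeasurable (by
      filter_upwards [ae_pathModTime_lt_top hd x, ae_pathModTime_lt_top hd y] with w h1 h2
      exact ENNReal.mul_lt_top h1 h2)
  simp only [Pi.mul_apply, ENNReal.toReal_mul, lintegral_pathModTime_mul hd,
    ENNReal.toReal_ofNat] at h
  exact h

variable {ι : Type*} [Fintype ι]

lemma integrable_combTime (hd : 3 ≤ d) (a : ι → ℝ) (z : ι → Site d) :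
    Integrable (combTime a z) (intensity d) :=
  integrable_finsetSum _ fun i _ => (integrable_realTime hd (z i)).const_mul (a i)

lemma integral_combTime (hd : 3 ≤ d) (a : ι → ℝ) (z : ι → Site d) :
    ∫ w, combTime a z w ∂intensity d = ∑ i, a i := by
  simp only [combTime]
  rw [integral_finsetSum _ fun i _ => (integrable_realTime hd (z i)).const_mul (a i)]
  simp [integral_const_mul, integral_realTime hd]

lemma integrable_combTime_sq (hd : 3 ≤ d) (a : ι → ℝ) (z : ι → Site d) :
    Integrable (fun w => combTime a z w ^ 2) (intensity d) := by
  simp only [combTime, sq, Finset.sum_mul_sum]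
  refine integrable_finsetSum _ fun i _ => integrable_finsetSum _ fun j _ => ?_
  simp only [mul_mul_mul_comm]
  exact (integrable_realTime_mul hd _ _).const_mul _

lemma integral_combTime_sq (hd : 3 ≤ d) (a : ι → ℝ) (z : ι → Site d) :
    ∫ w, combTime a z w ^ 2 ∂intensity d =
      2 * ∑ i, ∑ j, a i * a j * green (z i) (z j) := by
  have hi (i j : ι) : Integrable (fun w => a i * a j * (realTime (z i) w * realTime (z j) w))
      (intensity d) := (integrable_realTime_mul hd _ _).const_mul _
  simp only [combTime, sq, Finset.sum_mul_sum, mul_mul_mul_comm]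
  rw [integral_finsetSum _ fun i _ => integrable_finsetSum _ fun j _ => hi i j, Finset.mul_sum]
  refine Finset.sum_congr rfl fun i _ => ?_
  rw [integral_finsetSum _ fun j _ => hi i j, Finset.mul_sum]
  refine Finset.sum_congr rfl fun j _ => ?_
  rw [integral_const_mul, integral_realTime_mul hd]
  ring

end Moments

end Interlacement

/-! ### Occupation times -/

namespace Interlacement

section Occupation

variable {d : ℕ} {Ω : Type*} [MeasurableSpace Ω] {P : Measure Ω}
  {N : Ω → Measure (PathMod d × ℝ≥0)} {ι : Type*} [Fintype ι]

lemma measurable_pathModTime_level (x : Site d) (u : ℝ) :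
    Measurable fun p : PathMod d × ℝ≥0 => if (p.2 : ℝ) ≤ u then pathModTime x p.1 else 0 :=
  Measurable.ite (measurableSet_level d u) ((measurable_pathModTime x).comp measurable_fst)
    measurable_const

/-- A linear combination of times spent at finitely many sites, for a trajectory with label at most
`u`. -/
noncomputable def levelTime (a : ι → ℝ) (z : ι → Site d) (u : ℝ) : PathMod d × ℝ≥0 → ℝ :=
  {p : PathMod d × ℝ≥0 | (p.2 : ℝ) ≤ u}.indicator fun p => combTime a z p.1

lemma measurable_levelTime (a : ι → ℝ) (z : ι → Site d) (u : ℝ) : Measurable (levelTime a z u) :=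
  ((measurable_combTime a z).comp measurable_fst).indicator (measurableSet_level d u)


variable [NeZero d]

lemma measurable_occupationTime (hN : IsInterlacementProcess N P) (x : Site d) (u : ℝ) :
    Measurable fun ω => occupationTime (N ω) x u :=
  ((Measure.measurable_lintegral (measurable_pathModTime_level x u)).comp
    hN.measurable).ennreal_toReal

lemma lintegral_pathModTime_level (hd : 3 ≤ d) (x : Site d) (u : ℝ) :
    ∫⁻ p, (if (p.2 : ℝ) ≤ u then pathModTime x p.1 else 0) ∂(intensity d).prod levelMeasure =
      ENNReal.ofReal u := by
  have h1 : (fun p : PathMod d × ℝ≥0 => if (p.2 : ℝ) ≤ u then pathModTime x p.1 else 0) =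
      {p : PathMod d × ℝ≥0 | (p.2 : ℝ) ≤ u}.indicator (fun p => pathModTime x p.1) := by
    funext p
    simp [Set.indicator_apply]
  rw [h1, lintegral_indicator (measurableSet_level d u),
    ← lintegral_map (measurable_pathModTime x) measurable_fst, map_fst_restrict_level,
    lintegral_smul_measure, lintegral_pathModTime hd, smul_eq_mul, mul_one]

lemma integral_comp_fst_level {E : Type*} [NormedAddCommGroup E] [NormedSpace ℝ E]
    {G : PathMod d → E} (hG : AEStronglyMeasurable G (intensity d)) {u : ℝ} (hu : 0 ≤ u) :
    ∫ p, {p : PathMod d × ℝ≥0 | (p.2 : ℝ) ≤ u}.indicator (fun p => G p.1) p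
      ∂(intensity d).prod levelMeasure = u • ∫ w, G w ∂intensity d := by
  rw [integral_indicator (measurableSet_level d u), ← integral_map measurable_fst.aemeasurable,
    map_fst_restrict_level, integral_smul_measure, ENNReal.toReal_ofReal hu]
  rw [map_fst_restrict_level]
  exact hG.smul_measure _

lemma integrable_levelTime (hd : 3 ≤ d) (a : ι → ℝ) (z : ι → Site d) (u : ℝ) :
    Integrable (levelTime a z u) ((intensity d).prod levelMeasure) := by
  rw [levelTime, integrable_indicator_iff (measurableSet_level d u), IntegrableOn]
  have h : Integrable (combTime a z)
      ((((intensity d).prod levelMeasure).restrict {p | (p.2 : ℝ) ≤ u}).map Prod.fst) := by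
    rw [map_fst_restrict_level]
    exact (integrable_combTime hd a z).smul_measure ENNReal.ofReal_ne_top
  exact h.comp_measurable measurable_fst

/-- For `u ≥ 0` an occupation time has mean `u`, and for `u < 0` mean 0; it is therefore almost
surely finite, and the passage to real values commutes with linear combinations. -/
lemma ae_sum_occupationTime [IsProbabilityMeasure P] (hd : 3 ≤ d)
    (hN : IsInterlacementProcess N P) (a : ι → ℝ) (z : ι → Site d) (u : ℝ) :
    ∀ᵐ ω ∂P, ∑ i, a i * occupationTime (N ω) (z i) u = ∫ p, levelTime a z u p ∂N ω := by
  have hfin : ∀ᵐ ω ∂P, ∀ i, occupation (N ω) (z i) u < ∞ := ae_all_iff.2 fun i =>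
    hN.ae_lintegral_lt_top (measurable_pathModTime_level (z i) u)
      (by simp [lintegral_pathModTime_level hd])
  filter_upwards [hfin] with ω hω
  set g : ι → PathMod d × ℝ≥0 → ℝ≥0∞ := fun i p =>
    if (p.2 : ℝ) ≤ u then pathModTime (z i) p.1 else 0 with hg
  have hgm (i) : Measurable (g i) := measurable_pathModTime_level (z i) u
  have hlevel : levelTime a z u = fun p => ∑ i, a i * (g i p).toReal := by
    funext p
    by_cases hp : (p.2 : ℝ) ≤ u <;> simp [levelTime, combTime, realTime, hg, hp]
  have hint (i) : Integrable (fun p => a i * (g i p).toReal) (N ω) :=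
    (integrable_toReal_of_lintegral_ne_top (hgm i).aemeasurable (hω i).ne).const_mul _
  rw [hlevel, integral_finsetSum _ fun i _ => hint i]
  refine Finset.sum_congr rfl fun i _ => ?_
  rw [integral_const_mul, integral_toReal (hgm i).aemeasurable (ae_lt_top (hgm i) (hω i).ne)]
  rfl

/-- The characteristic function of a linear combination of occupation times. -/
lemma integral_exp_sum_occupationTime [IsProbabilityMeasure P] (hd : 3 ≤ d)
    (hN : IsInterlacementProcess N P) (a : ι → ℝ) (z : ι → Site d) {u : ℝ} (hu : 0 ≤ u) (r : ℝ) :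
    ∫ ω, Complex.exp (((∑ i, a i * occupationTime (N ω) (z i) u) / r : ℝ) * Complex.I) ∂P =
      Complex.exp (u * ∫ w, (Complex.exp ((combTime a z w / r : ℝ) * Complex.I) - 1)
        ∂intensity d) := by
  have hm := (measurable_levelTime a z u).div_const r
  have hi := (integrable_levelTime hd a z u).div_const r
  have hN' : IsPoissonPointProcess N ((intensity d).prod levelMeasure) P := hN
  have h1 : ∀ᵐ ω ∂P,
      Complex.exp (((∑ i, a i * occupationTime (N ω) (z i) u) / r : ℝ) * Complex.I) =
      Complex.exp ((∫ p, levelTime a z u p / r ∂N ω : ℝ) * Complex.I) := by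
    filter_upwards [ae_sum_occupationTime hd hN a z u] with ω hω
    rw [hω, integral_div]
  rw [integral_congr_ae h1, hN'.integral_exp hm hi]
  congr 1
  have hG : Measurable fun w => Complex.exp ((combTime a z w / r : ℝ) * Complex.I) - 1 := by
    have := measurable_combTime a z
    fun_prop
  -- The indicator of the level can be moved outside the exponential because `exp 0 - 1 = 0`;
  -- integrating out the label then yields the factor `u`.
  have h2 := integral_comp_fst_level hG.aestronglyMeasurable hu
  rw [Complex.real_smul] at h2
  rw [← h2]
  refine integral_congr_ae (ae_of_all _ fun p => ?_)
  by_cases hp : (p.2 : ℝ) ≤ u <;> simp [levelTime, hp]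

lemma tendsto_integral_exp_sum_occupationTime_div [IsProbabilityMeasure P] (hd : 3 ≤ d)
    (hN : IsInterlacementProcess N P) (a : ι → ℝ) (z : ι → Site d) :
    Tendsto (fun u : ℝ => ∫ ω, Complex.exp
      (((∑ i, a i * occupationTime (N ω) (z i) u) / u : ℝ) * Complex.I) ∂P) atTop
      (nhds (Complex.exp ((∑ i, a i : ℝ) * Complex.I))) := by
  have h := tendsto_mul_integral_exp_div_sub_one (integrable_combTime hd a z)
  rw [integral_combTime hd] at h
  refine ((Complex.continuous_exp.tendsto _).comp h).congr' ?_
  filter_upwards [eventually_ge_atTop 0] with u hu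
  exact (integral_exp_sum_occupationTime hd hN a z hu u).symm

lemma tendsto_integral_exp_sum_occupationTime_div_sqrt [IsProbabilityMeasure P] (hd : 3 ≤ d)
    (hN : IsInterlacementProcess N P) (a : ι → ℝ) (z : ι → Site d) (h0 : ∑ i, a i = 0) :
    Tendsto (fun u : ℝ => ∫ ω, Complex.exp
      (((∑ i, a i * occupationTime (N ω) (z i) u) / √(2 * u) : ℝ) * Complex.I) ∂P) atTop
      (nhds (Complex.exp (-((∑ i, ∑ j, a i * a j * green (z i) (z j)) / 2 : ℝ)))) := by
  have h := tendsto_mul_integral_exp_div_sqrt_sub_one (integrable_combTime hd a z)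
    (integrable_combTime_sq hd a z) ((integral_combTime hd a z).trans h0)
  -- The factor 2 in the second moment against the `1/4` of the expansion leaves the `1/2` of a
  -- Gaussian exponent; this is why the normalization is `√(2u)`.
  rw [integral_combTime_sq hd, mul_comm, mul_div_assoc, show (2 : ℝ) / 4 = 1 / 2 by norm_num,
    mul_one_div] at h
  refine ((Complex.continuous_exp.tendsto _).comp h).congr' ?_
  filter_upwards [eventually_ge_atTop 0] with u hu
  exact (integral_exp_sum_occupationTime hd hN a z hu _).symm

/-- The characteristic function of a linear combination of values of the Gaussian free field. -/
lemma IsGaussianFreeField.integral_exp [IsProbabilityMeasure P] {γ : Site d → Ω → ℝ}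
    (hγ : IsGaussianFreeField γ P) (a : ι → ℝ) (z : ι → Site d) :
    ∫ ω, Complex.exp ((∑ i, a i * γ (z i) ω : ℝ) * Complex.I) ∂P =
      Complex.exp (-((∑ i, ∑ j, a i * a j * green (z i) (z j)) / 2 : ℝ)) := by
  have hlaw : HasGaussianLaw (fun ω => ∑ i, a i * γ (z i) ω) P :=
    ((hγ.gaussian.comp_right z).smul a).hasGaussianLaw_fun_sum (I := Finset.univ)
  have hL2 (x : Site d) : MemLp (γ x) 2 P := (hγ.gaussian.hasGaussianLaw_eval x).memLp_two
  have hmean : ∫ ω, ∑ i, a i * γ (z i) ω ∂P = 0 := by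
    rw [integral_finsetSum _ fun i _ => ((hL2 (z i)).integrable (by norm_num)).const_mul _]
    simp [integral_const_mul, hγ.centered]
  have hvar : Var[fun ω => ∑ i, a i * γ (z i) ω; P] =
      ∑ i, ∑ j, a i * a j * green (z i) (z j) := by
    have hi (i j : ι) : Integrable (fun ω => a i * a j * (γ (z i) ω * γ (z j) ω)) P :=
      ((hL2 (z i)).integrable_mul (hL2 (z j))).const_mul _
    rw [variance_of_integral_eq_zero hlaw.aemeasurable hmean]
    simp only [sq, Finset.sum_mul_sum, mul_mul_mul_comm]
    rw [integral_finsetSum _ fun i _ => integrable_finsetSum _ fun j _ => hi i j]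
    refine Finset.sum_congr rfl fun i _ => ?_
    rw [integral_finsetSum _ fun j _ => hi i j]
    exact Finset.sum_congr rfl fun j _ => by rw [integral_const_mul, hγ.covariance]
  have h := hlaw.charFun_map_eq (1 : ℝ)
  rw [charFun_apply_real, integral_map hlaw.aemeasurable (by fun_prop)] at h
  simp only [Complex.ofReal_one, one_mul, Real.inner_apply, hmean, hvar] at h
  rw [h]
  congr 1
  push_cast
  ring

end Occupation

end Interlacement

/-! ### The two limit theorems. -/

theorem theorem5p1 (d : ℕ) [NeZero d] (hd : 3 ≤ d)
    {Ω : Type*} [MeasurableSpace Ω] (P : Measure Ω) [IsProbabilityMeasure P]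
    (N : Ω → Measure (Interlacement.PathMod d × ℝ≥0))
    (hN : Interlacement.IsInterlacementProcess N P)
    {Ω' : Type*} [MeasurableSpace Ω'] (P' : Measure Ω') [IsProbabilityMeasure P']
    (γ : Interlacement.Site d → Ω' → ℝ) (hγ : Interlacement.IsGaussianFreeField γ P') :
    TendstoInDistribution
      (fun (u : ℝ) (ω : Ω) (x : Interlacement.Site d) =>
        (Interlacement.occupationTime (N ω) x u - Interlacement.occupationTime (N ω) 0 u) /
          √(2 * u))
      atTop (fun (ω' : Ω') (x : Interlacement.Site d) => γ x ω' - γ 0 ω') (fun _ => P) P' ∧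
    TendstoInDistribution
      (fun (u : ℝ) (ω : Ω) (x : Interlacement.Site d) =>
        Interlacement.occupationTime (N ω) x u / u)
      atTop (fun (_ : Ω) (_ : Interlacement.Site d) => (1 : ℝ)) (fun _ => P) P := by
  have hL := Interlacement.measurable_occupationTime hN
  refine ⟨tendstoInDistribution_pi_of_tendsto_charFun
    (fun u => (measurable_pi_lambda _ fun x =>
      ((hL x u).sub (hL 0 u)).div_const _).aemeasurable)
    (aemeasurable_pi_lambda _ fun x => (hγ.gaussian.aemeasurable x).sub (hγ.gaussian.aemeasurable 0))
    fun S t => ?_,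
    tendstoInDistribution_pi_of_tendsto_charFun
      (fun u => (measurable_pi_lambda _ fun x => (hL x u).div_const _).aemeasurable)
      aemeasurable_const fun S t => ?_⟩
  -- Each site `i` of `S` is paired with a copy of the origin of weight `-t i`. The weights then sum
  -- to zero, and no case distinction on whether the origin lies in `S` is needed.
  · let a : S ⊕ S → ℝ := Sum.elim t fun i => -t i
    let z : S ⊕ S → Interlacement.Site d := Sum.elim (fun i => i) fun _ => 0
    have hsum (f : Interlacement.Site d → ℝ) :
        ∑ i, a i * f (z i) = ∑ i : S, t i * (f i - f 0) := by
      simp [a, z, Fintype.sum_sum_type, mul_add, Finset.sum_add_distrib, sub_eq_add_neg]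
    have h0 : ∑ i, a i = 0 := by simp [a, Fintype.sum_sum_type]
    have h := Interlacement.tendsto_integral_exp_sum_occupationTime_div_sqrt hd hN a z h0
    rw [← hγ.integral_exp a z] at h
    have hsumL (u : ℝ) (ω : Ω) := hsum fun x => Interlacement.occupationTime (N ω) x u
    have hsumγ (ω : Ω') := hsum fun x => γ x ω
    simp only [hsumL, hsumγ] at h
    simp only [Finset.sum_div, mul_div_assoc] at h
    exact h
  -- The limit `exp(i ∑ t i)` is the characteristic function of the constant field 1.
  · have h := Interlacement.tendsto_integral_exp_sum_occupationTime_div hd hN t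
      fun i : S => (i : Interlacement.Site d)
    simpa [Finset.sum_div, mul_div_assoc] using h
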